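/- **Setting.** Let $\Sigma$ be a finite alphabet with a total precedence, let $\lambda$ be the empty string, and let $\succ$ be the induced length-lexicographic ordering on $\Sigma^*$. An equation $s\approx t$ is an unordered pair of strings. Literals are equations $s\approx t$ and negated equations $s\not\approx t$; a clause is a finite multiset of literals (a disjunction). A *conditional equation* is a clause $s_1\not\approx t_1\vee\dots\vee s_n\not\approx t_n\vee l\approx r$ with $n\ge 0$; a *conditional equational theory* is a set of conditional equations. A selection function, fixed throughout, selects exactly one negative literal in every clause containing one, and nothing in the others. Below, $\bowtie$ is $\approx$ or $\not\approx$. **Inference system $\mathfrak S$.** - *Superposition:* from $C\vee u_1u_2\approx s$ and $D\vee u_2u_3\approx t$ infer $C\vee D\vee u_1t\approx su_3$, if $u_2\ne\lambda$, neither $C$ nor $D$ contains a selected literal, $u_1u_2\succ s$ and $u_2u_3\succ t$. - *Rewrite:* from $C\vee u_1u_2u_3\bowtie s$ and $D\vee u_2\approx t$ infer $C\vee D\vee u_1tu_3\bowtie s$, if $u_1u_2u_3\bowtie s$ is selected when $\bowtie$ is $\not\approx$, $C$ contains no selected literal when $\bowtie$ is $\approx$, $D$ contains no selected literal, and $u_2\succ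 t$. - *Equality Resolution:* from $C\vee s\not\approx s$, with $s\not\approx s$ selected, infer $C$. - *Paramodulation:* from $C\vee s\approx u_1u_2$ and $D\vee u_2u_3\approx t$ infer $C\vee D\vee su_3\approx u_1t$, if $u_2\neq\lambda$, $C$ contains a positive literal, neither $C$ nor $D$ contains a selected literal, $s\succ u_1u_2$ and $u_2u_3\succ t$. - *Factoring:* from $C\vee s\approx t\vee su\approx tu$ infer $C\vee su\approx tu$, if $C$ contains no selected literal. **Semantics.** Ground terms are the expressions $u\bot$ with $u\in\Sigma^*$. A *g-clause* of a clause $C$ is obtained by replacing each positive literal $s\approx t$ by $sw\bot\approx tw\bot$ for some string $w$ (chosen independently for each positive literal) and each negative literal $s\not\approx t$ by $s\bot\not\approx t\bot$. A Herbrand interpretation is a congruence on ground terms, where each letter $a$ acts as the unary function $u\bot\mapsto au\bot$. It satisfies $C$ if all g-clauses of $C$ are true in it. $R\models C$ means that every Herbrand interpretation satisfying all clauses of $R$ satisfies $C$; $\models$ between g-clauses is defined likewise. **Redundancy.** Order ground terms length-lexicographically with $\bot$ the smallest letter. Identify $s\approx t$ with $\{\{s\},\{t\}\}$ and $s\not\approx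 t$ with $\{\{s,t\}\}$, and order literals and g-clauses by multiset extension; write $\succ_g$. A clause is *redundant* w.r.t. $S$ if each of its g-clauses $C'$ follows from finitely many g-clauses $C_i'$ of clauses in $S$ with $C'\succ_g C_i'$. A *g-instance* of an inference is an inference by $\mathfrak S$ between g-clauses of its premises and of its conclusion, with selection inherited from the premises. An inference is *redundant* w.r.t. $S$ if for each of its g-instances, with maximal premise $C'$ and conclusion $D'$, the g-clause $D'$ follows from finitely many g-clauses $C_i'$ of clauses in $S$ with $C'\succ_g C_i'$. **Derivations.** A *theorem proving derivation* is a finite or infinite sequence $S_0,S_1,\dots$ of sets of clauses in which each step either - adds the conclusion of an inference of $\mathfrak S$ with premises in $S_{i-1}$, or - adds a clause $C\vee l_1rl_2\bowtie v$, where $C\vee l_1ll_2\bowtie v$ and $l\approx r$ are in $S_{i-1}$, $l_1\ne\lambda$, $l\succ r$, and $l_1ll_2\bowtie v$ is selected if $\bowtie$ is $\not\approx$ (Simplification), or - deletes a clause that is redundant w.r.t. $S_{i-1}$. Its *limit* is $S_\infty=\bigcup_i\bigcap_{j\ge i}S_j$ (the last set, if the derivation is finite). It is *fair* if every inference of $\mathfrak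 S$ with premises in $S_\infty$ is redundant w.r.t. $\bigcup_jS_j$. **Corollary.** Let $R$ be a conditional equational theory and let $R=R_0,R_1,\dots$ be a fair theorem proving derivation w.r.t. $\mathfrak S$ whose limit $R_\infty$ is finite. Then the word problems w.r.t. $R$ are decidable: there is an algorithm which, given $s,t\in\Sigma^*$, decides whether $R\models s\approx t$. -/

import Mathlib

namespace StringSup

/-! ## Strings, literals, clauses and orderings

Everything here is over an arbitrary alphabet `β`, because the inference rules are used twice:
for strings over the alphabet `α`, and for ground terms, which are strings over `WithBot α`. -/

/-- A literal: an unordered equation `s ≈ t` or its negation `s ≉ t`. -/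
inductive Literal (β : Type*) where
  | pos : Sym2 (List β) → Literal β
  | neg : Sym2 (List β) → Literal β

/-- The positive literal `s ≈ t`. -/
def eqn {β : Type*} (s t : List β) : Literal β := Literal.pos s(s, t)

/-- The negative literal `s ≉ t`. -/
def neqn {β : Type*} (s t : List β) : Literal β := Literal.neg s(s, t)

def Literal.IsPos {β : Type*} : Literal β → Prop
  | .pos _ => True
  | .neg _ => False

def Literal.IsNeg {β : Type*} : Literal β → Prop
  | .pos _ => False
  | .neg _ => True

/-- Apply a function to both sides of a literal. -/
def Literal.map {β γ : Type*} (f : List β → List γ) : Literal β → Literal γ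
  | .pos e => .pos (e.map f)
  | .neg e => .neg (e.map f)

/-- A clause is a finite multiset of literals. -/
abbrev Clause (β : Type*) := Multiset (Literal β)

/-- `s ≻ t` in the length-lexicographic ordering induced by the precedence `<` on letters. -/
def StrGT {β : Type*} [LT β] (s t : List β) : Prop :=
  List.Shortlex (fun a b : β => a < b) t s

open Classical in
/-- The extension of an ordering `gt` to finite multisets: `M ≻ N` if `M ≠ N` and whenever
`N(x) > M(x)` then `M(y) > N(y)` for some `y ≻ x`. -/
def MulGT {X : Type*} (gt : X → X → Prop) (M N : Multiset X) : Prop :=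
  M ≠ N ∧ ∀ x, M.count x < N.count x → ∃ y, gt y x ∧ N.count y < M.count y

/-- `s ≈ t` is identified with `{{s}, {t}}`, and `s ≉ t` with `{{s, t}}`. -/
def Literal.toMultisets {β : Type*} : Literal β → Multiset (Multiset (List β))
  | .pos e => e.toMultiset.map (fun s => {s})
  | .neg e => {e.toMultiset}

def LitGT {β : Type*} [LT β] (L K : Literal β) : Prop :=
  MulGT (MulGT StrGT) L.toMultisets K.toMultisets

def ClauseGT {β : Type*} [LT β] (C D : Clause β) : Prop :=
  MulGT LitGT C D

/-! ## The inference system -/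

/-- A clause together with its selected literal, if there is one. -/
abbrev MarkedClause (β : Type*) := Clause β × Option (Literal β)

/-- No literal of `C` is the selected literal `σ`. -/
def NoSelected {β : Type*} (σ : Option (Literal β)) (C : Clause β) : Prop :=
  ∀ L ∈ C, σ ≠ some L

/-- The inferences of the system: `Infers Ps D` says that `D` is the conclusion of an inference
whose premises (each with its selected literal) are, in this order, the members of `Ps`. -/
inductive Infers {β : Type*} [LT β] : List (MarkedClause β) → Clause β → Prop
  | superposition (C D : Clause β) (σ τ : Option (Literal β)) (u₁ u₂ u₃ s t : List β) :
      u₂ ≠ [] → NoSelected σ C → NoSelected τ D →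
      StrGT (u₁ ++ u₂) s → StrGT (u₂ ++ u₃) t →
      Infers [(C + {eqn (u₁ ++ u₂) s}, σ), (D + {eqn (u₂ ++ u₃) t}, τ)]
        (C + D + {eqn (u₁ ++ t) (s ++ u₃)})
  | rewritePos (C D : Clause β) (σ τ : Option (Literal β)) (u₁ u₂ u₃ s t : List β) :
      NoSelected σ C → NoSelected τ D → StrGT u₂ t →
      Infers [(C + {eqn (u₁ ++ u₂ ++ u₃) s}, σ), (D + {eqn u₂ t}, τ)]
        (C + D + {eqn (u₁ ++ t ++ u₃) s})
  | rewriteNeg (C D : Clause β) (σ τ : Option (Literal β)) (u₁ u₂ u₃ s t : List β) :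
      σ = some (neqn (u₁ ++ u₂ ++ u₃) s) → NoSelected τ D → StrGT u₂ t →
      Infers [(C + {neqn (u₁ ++ u₂ ++ u₃) s}, σ), (D + {eqn u₂ t}, τ)]
        (C + D + {neqn (u₁ ++ t ++ u₃) s})
  | equalityResolution (C : Clause β) (σ : Option (Literal β)) (s : List β) :
      σ = some (neqn s s) →
      Infers [(C + {neqn s s}, σ)] C
  | paramodulation (C D : Clause β) (σ τ : Option (Literal β)) (u₁ u₂ u₃ s t : List β) :
      u₂ ≠ [] → NoSelected σ C → (∃ L ∈ C, L.IsPos) → NoSelected τ D →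
      StrGT s (u₁ ++ u₂) → StrGT (u₂ ++ u₃) t →
      Infers [(C + {eqn s (u₁ ++ u₂)}, σ), (D + {eqn (u₂ ++ u₃) t}, τ)]
        (C + D + {eqn (s ++ u₃) (u₁ ++ t)})
  | factoring (C : Clause β) (σ : Option (Literal β)) (s t u : List β) :
      NoSelected σ C →
      Infers [(C + {eqn s t} + {eqn (s ++ u) (t ++ u)}, σ)] (C + {eqn (s ++ u) (t ++ u)})

/-- A selection function: it selects exactly one negative literal in each clause that contains
a negative literal, and nothing in the other clauses. -/
structure Selection (α : Type*) where
  sel : Clause α → Option (Literal α)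
  sel_mem : ∀ C L, sel C = some L → L ∈ C ∧ L.IsNeg
  sel_isSome : ∀ C, (∃ L ∈ C, L.IsNeg) → (sel C).isSome

/-- `D` is the conclusion of an inference with the list of premises `Ps`, the literals being
selected by `f`. -/
def IsInference {α : Type*} [LT α] (f : Selection α) (Ps : List (Clause α)) (D : Clause α) :
    Prop :=
  Infers (Ps.map fun C => (C, f.sel C)) D

/-! ## Ground terms and ground clauses

The ground term `u⊥` is the string `u` followed by the letter `⊥` of `WithBot α`, which is
smaller than all letters of `α`. -/

def gterm {α : Type*} (u : List α) : List (WithBot α) :=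
  u.map (fun a => (a : WithBot α)) ++ [⊥]

/-- `IsGLiteral L L'`: `L'` is a ground instance of `L`. A positive literal `s ≈ t` has the
instances `sw⊥ ≈ tw⊥` for all strings `w`, a negative literal `s ≉ t` only `s⊥ ≉ t⊥`. -/
inductive IsGLiteral {α : Type*} : Literal α → Literal (WithBot α) → Prop
  | pos (s t w : List α) : IsGLiteral (eqn s t) (eqn (gterm (s ++ w)) (gterm (t ++ w)))
  | neg (s t : List α) : IsGLiteral (neqn s t) (neqn (gterm s) (gterm t))

/-- `IsGClause C C'`: `C'` is a ground clause (g-clause) of `C`. The strings appended to the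
positive literals are independent of each other. -/
def IsGClause {α : Type*} (C : Clause α) (C' : Clause (WithBot α)) : Prop :=
  Multiset.Rel IsGLiteral C C'

/-! ## Herbrand interpretations -/

/-- An equality Herbrand interpretation: a congruence on the ground terms `u⊥`, where each
letter acts as a unary function `u⊥ ↦ au⊥`. The string `u` stands for `u⊥`. -/
structure Interp (α : Type*) where
  rel : List α → List α → Prop
  equiv : Equivalence rel
  congr : ∀ (a : α) (u v : List α), rel u v → rel (a :: u) (a :: v)

/-- The ground equation `e` holds in `I`. -/
def Interp.HoldsEq {α : Type*} (I : Interp α) (e : Sym2 (List (WithBot α))) : Prop :=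
  ∃ u v, e = s(gterm u, gterm v) ∧ I.rel u v

def Interp.SatLit {α : Type*} (I : Interp α) : Literal (WithBot α) → Prop
  | .pos e => I.HoldsEq e
  | .neg e => ¬ I.HoldsEq e

/-- The ground clause `C'` is true in `I`. -/
def Interp.SatG {α : Type*} (I : Interp α) (C' : Clause (WithBot α)) : Prop :=
  ∃ L ∈ C', I.SatLit L

/-- `I` satisfies a clause over strings if it satisfies all its ground clauses. -/
def Interp.Sat {α : Type*} (I : Interp α) (C : Clause α) : Prop :=
  ∀ C', IsGClause C C' → I.SatG C'

/-- `S ⊨ C` for clauses over strings. -/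
def Entails {α : Type*} (S : Set (Clause α)) (C : Clause α) : Prop :=
  ∀ I : Interp α, (∀ K ∈ S, I.Sat K) → I.Sat C

/-- `N ⊨ C'` for ground clauses. -/
def GEntails {α : Type*} (N : Set (Clause (WithBot α))) (C' : Clause (WithBot α)) : Prop :=
  ∀ I : Interp α, (∀ K ∈ N, I.SatG K) → I.SatG C'

/-! ## Redundancy -/

/-- The ground clause `D'` follows from finitely many ground clauses of clauses in `S` that are
all smaller than `B'`. -/
def FollowsBelow {α : Type*} [LT α] (S : Set (Clause α)) (B' D' : Clause (WithBot α)) : Prop :=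
  ∃ N : Set (Clause (WithBot α)), N.Finite ∧
    (∀ K' ∈ N, (∃ K ∈ S, IsGClause K K') ∧ ClauseGT B' K') ∧ GEntails N D'

/-- The clause `C` is redundant w.r.t. `S`: all its ground clauses are. -/
def RedundantClause {α : Type*} [LT α] (S : Set (Clause α)) (C : Clause α) : Prop :=
  ∀ C', IsGClause C C' → FollowsBelow S C' C'

/-- `Ps'` and `D'` form a ground instance of the inference with premises `Ps` and conclusion `D`:
an inference between ground clauses of the premises and of the conclusion, in which the literals
that come from selected literals are selected. -/
def IsGInstance {α : Type*} [LT α] (f : Selection α) (Ps : List (Clause α)) (D : Clause α)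
    (Ps' : List (MarkedClause (WithBot α))) (D' : Clause (WithBot α)) : Prop :=
  List.Forall₂ (fun C P' => IsGClause C P'.1 ∧ P'.2 = (f.sel C).map (Literal.map gterm)) Ps Ps' ∧
    IsGClause D D' ∧ Infers Ps' D'

/-- The inference with premises `Ps` and conclusion `D` is redundant w.r.t. `S`. -/
def RedundantInference {α : Type*} [LT α] (f : Selection α) (S : Set (Clause α))
    (Ps : List (Clause α)) (D : Clause α) : Prop :=
  ∀ Ps' D', IsGInstance f Ps D Ps' D' →
    ∀ B' ∈ Ps'.map Prod.fst, (∀ P' ∈ Ps'.map Prod.fst, ¬ ClauseGT P' B') → FollowsBelow S B' D'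

/-! ## Derivations -/

/-- `Simplifies f D l r D'`: the equation `l ≈ r` simplifies the clause `D` into `D'`. -/
inductive Simplifies {α : Type*} [LT α] (f : Selection α) :
    Clause α → List α → List α → Clause α → Prop
  | pos (C : Clause α) (l₁ l l₂ r v : List α) : l₁ ≠ [] → StrGT l r →
      Simplifies f (C + {eqn (l₁ ++ l ++ l₂) v}) l r (C + {eqn (l₁ ++ r ++ l₂) v})
  | neg (C : Clause α) (l₁ l l₂ r v : List α) : l₁ ≠ [] → StrGT l r →
      f.sel (C + {neqn (l₁ ++ l ++ l₂) v}) = some (neqn (l₁ ++ l ++ l₂) v) →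
      Simplifies f (C + {neqn (l₁ ++ l ++ l₂) v}) l r (C + {neqn (l₁ ++ r ++ l₂) v})

/-- One step of a theorem proving derivation. A contraction by Simplification consists of the
step `simplify` followed by the deletion of the simplified clause, which has become redundant.
The step `idle` only serves to write a finite derivation as an infinite sequence, by repeating
its last set. -/
inductive Step {α : Type*} [LT α] (f : Selection α) : Set (Clause α) → Set (Clause α) → Prop
  | deduce (S : Set (Clause α)) (Ps : List (Clause α)) (C : Clause α) :
      (∀ P ∈ Ps, P ∈ S) → IsInference f Ps C → Step f S (S ∪ {C})
  | simplify (S : Set (Clause α)) (D D' : Clause α) (l r : List α) :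
      D ∈ S → {eqn l r} ∈ S → Simplifies f D l r D' → Step f S (S ∪ {D'})
  | delete (S : Set (Clause α)) (D : Clause α) :
      RedundantClause S D → Step f S (S \ {D})
  | idle (S : Set (Clause α)) : Step f S S

def IsDerivation {α : Type*} [LT α] (f : Selection α) (S : ℕ → Set (Clause α)) : Prop :=
  ∀ i, Step f (S i) (S (i + 1))

/-- The limit `⋃ i, ⋂ j ≥ i, S j` of a derivation. -/
def limitSet {α : Type*} (S : ℕ → Set (Clause α)) : Set (Clause α) :=
  ⋃ i, ⋂ j ≥ i, S j

/-- Every inference with premises in the limit is redundant w.r.t. `⋃ j, S j`. -/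
def Fair {α : Type*} [LT α] (f : Selection α) (S : ℕ → Set (Clause α)) : Prop :=
  ∀ Ps D, (∀ P ∈ Ps, P ∈ limitSet S) → IsInference f Ps D → RedundantInference f (⋃ j, S j) Ps D

/-! ## Conditional equational theories -/

/-- A conditional equation `s₁ ≈ t₁ ∧ ⋯ ∧ sₙ ≈ tₙ → l ≈ r`, `n ≥ 0`. -/
def IsConditionalEquation {α : Type*} (C : Clause α) : Prop :=
  ∃ (Γ : Clause α) (l r : List α), (∀ L ∈ Γ, L.IsNeg) ∧ C = Γ + {eqn l r}

/-- The word problems w.r.t. `R` are decidable: it is computable from two strings `s` and `t`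
whether `R ⊨ s ≈ t`. -/
def DecidableWordProblems {α : Type*} [Primcodable α] (R : Set (Clause α)) : Prop :=
  ComputablePred fun p : List α × List α => Entails R {eqn p.1 p.2}

end StringSup

/-! Only the unit equations of the limit matter. Oriented by the length-lexicographic order, they
form a finite, terminating string rewriting system. It is confluent, and its joinability relation is
exactly entailment from the initial theory (`entails_iff_join`). So a word problem is solved by
computing two normal forms and comparing them.

One direction is soundness: every clause of the derivation is a consequence of the initial theory.
For the other, let `model M Q` be the congruence generated by those ground instances of unit
equations in `M` that lie in `Q`. Here `Q` is either the set of ground clauses below some `B` or the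
set of all ground clauses. Well-founded induction on ground clauses proves two statements together
(`Saturated.below_invariant`): critical pairs of these rules join, and ground clauses in `Q` of
clauses in `M` are true in the model.

An overlap of two rules gives an inference. By fairness its conclusion follows from ground clauses
below the larger premise, so it holds in a smaller model, which is confluent by induction; hence the
pair joins (`Saturated.criticalPairsJoin`). A clause with a selected literal `s ≉ t` is true without
contributing a rule (`Saturated.satG_below`). If `s ≈ t` holds in the model below it, then the two
sides are equal, or confluence makes one of them reducible. Equality Resolution or Rewrite then has
a redundant conclusion, which makes the rest of the clause true. Every other clause is a unit
equation, because all clauses keep exactly one positive literal, and it is a rule itself or trivial.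
Adding larger rules does not falsify the negative literals, since terms bounded by a side of such a
literal are rewritten only by rules below the clause (`reflTransGen_below`). Clauses that do not
persist are redundant, so the final model satisfies the initial theory. -/

namespace StringSup

/-! ## Properties of the orderings -/

/-- `gt` is a strict total order. -/
structure StrictTotal {X : Type*} (gt : X → X → Prop) : Prop where
  irrefl : ∀ x, ¬ gt x x
  trans : ∀ x y z, gt x y → gt y z → gt x z
  total : ∀ x y, gt x y ∨ x = y ∨ gt y x

theorem StrictTotal.asymm {X : Type*} {gt : X → X → Prop} (h : StrictTotal gt) {x y : X}
    (hxy : gt x y) : ¬ gt y x := fun hyx => h.irrefl x (h.trans _ _ _ hxy hyx)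

/-- A nonempty finite set has a maximal element with respect to a strict total order. -/
theorem StrictTotal.exists_max {X : Type*} {gt : X → X → Prop} (h : StrictTotal gt)
    (s : Multiset X) (P : X → Prop) (hP : ∃ x ∈ s, P x) :
    ∃ x ∈ s, P x ∧ ∀ y ∈ s, P y → ¬ gt y x := by
  induction s using Multiset.induction with
  | empty => simp at hP
  | cons a s ih =>
    by_cases hs : ∃ x ∈ s, P x
    · obtain ⟨x, hx, hPx, hmax⟩ := ih hs
      by_cases ha : P a ∧ gt a x
      · refine ⟨a, Multiset.mem_cons_self _ _, ha.1, fun y hy hPy hya => ?_⟩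
        rcases Multiset.mem_cons.1 hy with rfl | hy
        · exact h.irrefl _ hya
        · exact hmax y hy hPy (h.trans _ _ _ hya ha.2)
      · refine ⟨x, Multiset.mem_cons_of_mem hx, hPx, fun y hy hPy hyx => ?_⟩
        rcases Multiset.mem_cons.1 hy with rfl | hy
        · exact ha ⟨hPy, hyx⟩
        · exact hmax y hy hPy hyx
    · obtain ⟨x, hx, hPx⟩ := hP
      have hno : ∀ y ∈ s, ¬ P y := fun y hy hPy => hs ⟨y, hy, hPy⟩
      rcases Multiset.mem_cons.1 hx with rfl | hx
      · refine ⟨x, Multiset.mem_cons_self _ _, hPx, fun y hy hPy hyx => ?_⟩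
        rcases Multiset.mem_cons.1 hy with rfl | hy
        · exact h.irrefl _ hyx
        · exact hno y hy hPy
      · exact absurd hPx (hno x hx)

open Classical in
/-- Two different multisets have a greatest element at which they differ. -/
theorem StrictTotal.exists_max_count_ne {X : Type*} {gt : X → X → Prop} (h : StrictTotal gt)
    {M N : Multiset X} (hne : M ≠ N) :
    ∃ x, M.count x ≠ N.count x ∧ ∀ y, gt y x → M.count y = N.count y := by
  have hmem : ∀ x, M.count x ≠ N.count x → x ∈ M + N := by
    intro x hx
    by_contra hcon
    rw [Multiset.mem_add, not_or] at hcon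
    exact hx (by rw [Multiset.count_eq_zero_of_notMem hcon.1,
      Multiset.count_eq_zero_of_notMem hcon.2])
  obtain ⟨x, hx⟩ : ∃ x, M.count x ≠ N.count x := by
    by_contra! hcon
    exact hne (Multiset.ext.2 hcon)
  obtain ⟨z, -, hz, hmax⟩ :=
    h.exists_max (M + N) (fun x => M.count x ≠ N.count x) ⟨x, hmem x hx, hx⟩
  refine ⟨z, hz, fun y hy => ?_⟩
  by_contra hcon
  exact hmax y (hmem y hcon) hcon hy

-- Over a total order the greatest element at which two multisets differ decides the comparison.
-- With this single witness, transitivity and totality of the extension can be read off.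
open Classical in
theorem StrictTotal.mulGT_iff {X : Type*} {gt : X → X → Prop} (h : StrictTotal gt)
    {M N : Multiset X} :
    MulGT gt M N ↔ ∃ x, N.count x < M.count x ∧ ∀ y, gt y x → M.count y = N.count y := by
  constructor
  · rintro ⟨hne, hall⟩
    obtain ⟨x, hx, hmax⟩ := h.exists_max_count_ne hne
    refine ⟨x, ?_, hmax⟩
    by_contra hcon
    obtain ⟨y, hyx, hy⟩ := hall x (by omega)
    exact absurd (hmax y hyx) hy.ne'
  · rintro ⟨x, hx, hmax⟩
    refine ⟨fun he => by simp [he] at hx, fun z hz => ⟨x, ?_, hx⟩⟩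
    rcases h.total x z with hxz | rfl | hzx
    · exact hxz
    · omega
    · have := hmax z hzx
      omega

theorem StrictTotal.mulGT {X : Type*} {gt : X → X → Prop} (h : StrictTotal gt) :
    StrictTotal (MulGT gt) where
  irrefl M hM := hM.1 rfl
  trans M N P hMN hNP := by
    classical
    rw [h.mulGT_iff] at *
    obtain ⟨x, hx, hxm⟩ := hMN
    obtain ⟨y, hy, hym⟩ := hNP
    -- The larger of the two deciding elements decides between `M` and `P`.
    rcases h.total x y with hxy | rfl | hyx
    · exact ⟨x, (hym x hxy) ▸ hx, fun z hz => (hxm z hz).trans (hym z (h.trans _ _ _ hz hxy))⟩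
    · exact ⟨x, hy.trans hx, fun z hz => (hxm z hz).trans (hym z hz)⟩
    · exact ⟨y, (hxm y hyx).symm ▸ hy,
        fun z hz => (hxm z (h.trans _ _ _ hz hyx)).trans (hym z hz)⟩
  total M N := by
    classical
    rw [h.mulGT_iff, h.mulGT_iff]
    by_cases hne : M = N
    · exact Or.inr (Or.inl hne)
    · obtain ⟨x, hx, hmax⟩ := h.exists_max_count_ne hne
      rcases lt_or_gt_of_ne hx with hlt | hgt
      · exact Or.inr (Or.inr ⟨x, hlt, fun y hy => (hmax y hy).symm⟩)
      · exact Or.inl ⟨x, hgt, hmax⟩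

theorem StrictTotal.invImage {X Y : Type*} {gt : X → X → Prop} (h : StrictTotal gt) {g : Y → X}
    (hg : Function.Injective g) : StrictTotal (fun x y => gt (g x) (g y)) where
  irrefl _ := h.irrefl _
  trans _ _ _ := h.trans _ _ _
  total x y := (h.total (g x) (g y)).imp_right (Or.imp_left fun e => hg e)

/-- The multiset extension of a well-founded strict order is well-founded. -/
theorem wellFounded_mulGT {X : Type*} {gt : X → X → Prop} (h : StrictTotal gt)
    (hwf : WellFounded (fun x y => gt y x)) : WellFounded (fun M N => MulGT gt N M) := by
  classical
  let _ : Preorder X :=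
    { le := fun x y => x = y ∨ gt y x
      lt := fun x y => gt y x
      le_refl := fun x => Or.inl rfl
      le_trans := by
        rintro x y z (rfl | hxy) (rfl | hyz)
        · exact Or.inl rfl
        · exact Or.inr hyz
        · exact Or.inr hxy
        · exact Or.inr (h.trans _ _ _ hyz hxy)
      lt_iff_le_not_ge := by
        intro x y
        constructor
        · intro hxy
          refine ⟨Or.inr hxy, ?_⟩
          rintro (rfl | hyx)
          · exact h.irrefl _ hxy
          · exact h.asymm hxy hyx
        · rintro ⟨rfl | hxy, hn⟩
          · exact absurd (Or.inl rfl) hn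
          · exact hxy }
  have : WellFoundedLT X := ⟨hwf⟩
  refine Subrelation.wf (r := Multiset.IsDershowitzMannaLT) ?_
    Multiset.wellFounded_isDershowitzMannaLT
  intro M N hMN
  rw [h.mulGT_iff] at hMN
  obtain ⟨x, hx, hmax⟩ := hMN
  have hxs : x ∈ N - M := by
    rw [← Multiset.count_pos, Multiset.count_sub]
    omega
  -- In Dershowitz–Manna form: the common part is kept and `N - M` is replaced by `M - N`, all of
  -- whose elements lie below the deciding element `x`.
  refine ⟨M ∩ N, M - N, N - M, ?_, ?_, ?_, ?_⟩
  · intro he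
    rw [he] at hxs
    simp at hxs
  · rw [add_comm]
    exact (Multiset.sub_add_inter M N).symm
  · rw [add_comm, Multiset.inter_comm]
    exact (Multiset.sub_add_inter N M).symm
  · intro y hy
    refine ⟨x, hxs, ?_⟩
    rw [← Multiset.count_pos, Multiset.count_sub] at hy
    rcases h.total x y with hxy | rfl | hyx
    · exact hxy
    · omega
    · have := hmax y hyx
      omega

/-- A multiset with an element that dominates all elements of `N` is greater than `N`. -/
theorem StrictTotal.mulGT_of_forall {X : Type*} {gt : X → X → Prop} (h : StrictTotal gt)
    {M N : Multiset X} {z : X} (hz : z ∈ M) (hN : ∀ x ∈ N, gt z x) : MulGT gt M N := by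
  classical
  have hzN : z ∉ N := fun hzN => h.irrefl z (hN z hzN)
  refine ⟨fun he => hzN (he ▸ hz), fun x hx => ⟨z, hN x ?_, ?_⟩⟩
  · exact Multiset.count_pos.1 (by omega)
  · rw [Multiset.count_eq_zero_of_notMem hzN]
    exact Multiset.count_pos.2 hz

theorem mulGT_of_lt {X : Type*} {gt : X → X → Prop} {M N : Multiset X} (h : N < M) :
    MulGT gt M N := by
  classical
  exact ⟨h.ne', fun x hx => absurd (Multiset.count_le_of_le x h.le) (by omega)⟩

section Orders

variable {β : Type*} [LinearOrder β]

theorem strictTotal_strGT : StrictTotal (StrGT : List β → List β → Prop) where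
  irrefl s hs := by
    have h : Std.Asymm (List.Shortlex fun a b : β => a < b) := inferInstance
    exact h.asymm _ _ hs hs
  trans s t u hst htu := by
    unfold StrGT at *
    rw [List.shortlex_def] at *
    rcases hst with hst | ⟨hst, hst'⟩ <;> rcases htu with htu | ⟨htu, htu'⟩
    · exact Or.inl (by omega)
    · exact Or.inl (by omega)
    · exact Or.inl (by omega)
    · refine Or.inr ⟨by omega, ?_⟩
      exact lt_trans (α := List β) htu' hst'
  total s t := by
    rcases trichotomous_of (List.Shortlex fun a b : β => a < b) t s with h | h | h
    · exact Or.inl h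
    · exact Or.inr (Or.inl h.symm)
    · exact Or.inr (Or.inr h)

theorem wellFounded_strGT [WellFoundedLT β] :
    WellFounded (fun s t : List β => StrGT t s) :=
  List.Shortlex.wf wellFounded_lt

theorem toMultiset_injective {X : Type*} :
    Function.Injective (Sym2.toMultiset : Sym2 X → Multiset X) := fun e e' h =>
  Sym2.ext fun x => by rw [← Sym2.mem_toMultiset, h, Sym2.mem_toMultiset]

theorem Literal.toMultisets_injective {β : Type*} :
    Function.Injective (Literal.toMultisets : Literal β → Multiset (Multiset (List β))) := by
  rintro (e | e) (e' | e') h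
  · exact congrArg _ (toMultiset_injective
      (Multiset.map_injective (fun _ _ => Multiset.singleton_inj.1) h))
  · simpa [Literal.toMultisets, Sym2.card_toMultiset] using congrArg Multiset.card h
  · simpa [Literal.toMultisets, Sym2.card_toMultiset] using congrArg Multiset.card h
  · exact congrArg _ (toMultiset_injective (Multiset.singleton_inj.1 h))

theorem strictTotal_litGT : StrictTotal (LitGT : Literal β → Literal β → Prop) :=
  strictTotal_strGT.mulGT.mulGT.invImage Literal.toMultisets_injective

theorem strictTotal_clauseGT : StrictTotal (ClauseGT : Clause β → Clause β → Prop) :=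
  strictTotal_litGT.mulGT

/-- Three nested multiset extensions over the well-founded order on strings: two for a literal, one
more for a clause. -/
theorem wellFounded_clauseGT [WellFoundedLT β] :
    WellFounded (fun C D : Clause β => ClauseGT D C) :=
  wellFounded_mulGT strictTotal_litGT <| InvImage.wf Literal.toMultisets <|
    wellFounded_mulGT strictTotal_strGT.mulGT <|
      wellFounded_mulGT strictTotal_strGT wellFounded_strGT

/-- Equal lengths exclude the case of a proper prefix, in which `v` would be compared with the rest
of `t`. -/
theorem lex_append_right {s t : List β} (h : List.Lex (fun a b : β => a < b) s t)
    (hl : s.length = t.length) (v : List β) :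
    List.Lex (fun a b : β => a < b) (s ++ v) (t ++ v) := by
  induction h with
  | nil => simp at hl
  | cons _ ih => exact List.Lex.cons (ih (by simpa using hl))
  | rel h => exact List.Lex.rel h

theorem StrGT.append {s t : List β} (h : StrGT s t) (u v : List β) :
    StrGT (u ++ s ++ v) (u ++ t ++ v) := by
  unfold StrGT at *
  rw [List.shortlex_def] at *
  rcases h with h | ⟨h, h'⟩
  · left; simp; omega
  · right
    refine ⟨by simp [h], ?_⟩
    rw [List.append_assoc, List.append_assoc]
    exact List.Lex.append_left _ (lex_append_right h' h v) u

theorem StrGT.gterm {s t : List β} (h : StrGT s t) : StrGT (gterm s) (gterm t) := by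
  unfold StrGT at *
  rw [List.shortlex_def] at *
  rcases h with h | ⟨h, h'⟩
  · left; simpa [StringSup.gterm] using h
  · right
    refine ⟨by simp [StringSup.gterm, h], lex_append_right ?_ (by simp [h]) _⟩
    clear h
    induction h' with
    | nil => exact List.Lex.nil
    | cons _ ih => exact List.Lex.cons ih
    | rel h => exact List.Lex.rel (WithBot.coe_lt_coe.2 h)

/-- A negative literal is greater than an equation between terms that are bounded by one of its
sides. -/
theorem litGT_neqn_eqn {s t p q : List β} (hps : p = s ∨ StrGT s p) (hpq : StrGT p q) :
    LitGT (neqn s t) (eqn p q) := by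
  have ht := strictTotal_strGT (β := β)
  have hs : s ∈ ({s, t} : Multiset (List β)) := by simp
  refine ht.mulGT.mulGT_of_forall (z := {s, t}) (Multiset.mem_singleton_self _) ?_
  have hq : StrGT s q := by
    rcases hps with rfl | hps
    · exact hpq
    · exact ht.trans _ _ _ hps hpq
  intro M hM
  have hM' : M = {p} ∨ M = {q} := by
    simpa [Literal.toMultisets, eqn, eq_comm] using hM
  rcases hM' with rfl | rfl
  · rcases hps with rfl | hps
    -- Even with equal sides the negative literal wins, because `{s}` is a proper part of `{s, t}`.
    · exact mulGT_of_lt (by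
        rw [Multiset.pair_comm, Multiset.insert_eq_cons]
        exact Multiset.lt_cons_self _ _)
    · exact ht.mulGT_of_forall hs (by simpa using hps)
  · exact ht.mulGT_of_forall hs (by simpa using hq)

theorem litGT_eqn_eqn {p q p' q' : List β} (hp : StrGT p p') (hpq : StrGT p' q') :
    LitGT (eqn p q) (eqn p' q') := by
  have ht := strictTotal_strGT (β := β)
  refine ht.mulGT.mulGT_of_forall (z := {p}) (by simp [Literal.toMultisets, eqn]) ?_
  intro M hM
  have hM' : M = {p'} ∨ M = {q'} := by
    simpa [Literal.toMultisets, eqn, eq_comm] using hM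
  rcases hM' with rfl | rfl
  · exact ht.mulGT_of_forall (Multiset.mem_singleton_self _) (by simpa using hp)
  · exact ht.mulGT_of_forall (Multiset.mem_singleton_self _)
      (by simpa using ht.trans _ _ _ hp hpq)

/-- A clause is greater than a unit clause whose literal is smaller than one of its literals. -/
theorem clauseGT_singleton {C : Clause β} {L K : Literal β} (hL : L ∈ C) (h : LitGT L K) :
    ClauseGT C {K} :=
  strictTotal_litGT.mulGT_of_forall hL (by simpa using h)

end Orders

/-! ## Ground clauses and their truth -/

section Ground

variable {α : Type*}

theorem eqn_comm {β : Type*} (s t : List β) : eqn s t = eqn t s := congrArg _ Sym2.eq_swap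

theorem neqn_comm {β : Type*} (s t : List β) : neqn s t = neqn t s := congrArg _ Sym2.eq_swap

theorem gterm_eq (u : List α) : gterm u = u.map WithBot.some ++ [⊥] := by
  induction u with
  | nil => rfl
  | cons a u ih => exact congrArg (List.cons (a : WithBot α)) ih

theorem gterm_append (u v : List α) :
    gterm (u ++ v) = u.map WithBot.some ++ gterm v := by simp [gterm_eq]

theorem gterm_injective : Function.Injective (gterm : List α → List (WithBot α)) := by
  intro u v h
  rw [gterm_eq, gterm_eq] at h
  exact List.map_injective_iff.2 WithBot.coe_injective (List.append_cancel_right h)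

theorem isGLiteral_eqn {s t : List α} {L' : Literal (WithBot α)} :
    IsGLiteral (eqn s t) L' ↔ ∃ w, L' = eqn (gterm (s ++ w)) (gterm (t ++ w)) := by
  constructor
  · intro h
    generalize hL : eqn s t = L at h
    cases h with
    | pos s' t' w =>
      refine ⟨w, ?_⟩
      have h' : s(s, t) = s(s', t') := by simpa [eqn] using hL
      rcases Sym2.eq_iff.1 h' with ⟨rfl, rfl⟩ | ⟨rfl, rfl⟩
      · rfl
      · exact eqn_comm _ _
    | neg => simp [eqn, neqn] at hL
  · rintro ⟨w, rfl⟩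
    exact .pos s t w

theorem isGLiteral_neqn {s t : List α} {L' : Literal (WithBot α)} :
    IsGLiteral (neqn s t) L' ↔ L' = neqn (gterm s) (gterm t) := by
  constructor
  · intro h
    generalize hL : neqn s t = L at h
    cases h with
    | neg s' t' =>
      have h' : s(s, t) = s(s', t') := by simpa [neqn] using hL
      rcases Sym2.eq_iff.1 h' with ⟨rfl, rfl⟩ | ⟨rfl, rfl⟩
      · rfl
      · exact neqn_comm _ _
    | pos => simp [eqn, neqn] at hL
  · rintro rfl
    exact .neg s t

theorem isGClause_add {C D : Clause α} {E' : Clause (WithBot α)} :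
    IsGClause (C + D) E' ↔ ∃ C' D', IsGClause C C' ∧ IsGClause D D' ∧ E' = C' + D' :=
  Multiset.rel_add_left

theorem isGClause_singleton {L : Literal α} {E' : Clause (WithBot α)} :
    IsGClause {L} E' ↔ ∃ L', IsGLiteral L L' ∧ E' = {L'} := by
  rw [IsGClause, ← Multiset.cons_zero, Multiset.rel_cons_left]
  simp [Multiset.rel_zero_left]

namespace Interp

variable (I : Interp α)

theorem satLit_eqn {u v : List α} : I.SatLit (eqn (gterm u) (gterm v)) ↔ I.rel u v := by
  constructor
  · rintro ⟨u', v', h, h'⟩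
    rcases Sym2.eq_iff.1 h with ⟨h₁, h₂⟩ | ⟨h₁, h₂⟩
    · rwa [gterm_injective h₁, gterm_injective h₂]
    · rw [gterm_injective h₁, gterm_injective h₂]
      exact I.equiv.symm h'
  · exact fun h => ⟨u, v, rfl, h⟩

theorem satLit_neqn {u v : List α} : I.SatLit (neqn (gterm u) (gterm v)) ↔ ¬ I.rel u v :=
  not_congr I.satLit_eqn

theorem satG_add {C D : Clause (WithBot α)} : I.SatG (C + D) ↔ I.SatG C ∨ I.SatG D := by
  simp only [SatG, Multiset.mem_add, or_and_right, exists_or]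

theorem satG_singleton {L : Literal (WithBot α)} : I.SatG {L} ↔ I.SatLit L := by simp [SatG]

theorem rel_append_left {u v : List α} (h : I.rel u v) (w : List α) :
    I.rel (w ++ u) (w ++ v) := by
  induction w with
  | nil => exact h
  | cons a w ih => exact I.congr a _ _ ih

/-- The string appended to the distinguished equation is chosen independently of the ground clause
of `C`, so the quantifier over `w` may be moved inside the disjunction. -/
theorem sat_add_eqn {C : Clause α} {s t : List α} :
    I.Sat (C + {eqn s t}) ↔
      ∀ C', IsGClause C C' → I.SatG C' ∨ ∀ w, I.rel (s ++ w) (t ++ w) := by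
  constructor
  · intro h C' hC'
    by_contra! hcon
    obtain ⟨hC, w, hw⟩ := hcon
    have := h (C' + {eqn (gterm (s ++ w)) (gterm (t ++ w))})
      (isGClause_add.2 ⟨_, _, hC', isGClause_singleton.2 ⟨_, .pos s t w, rfl⟩, rfl⟩)
    rw [satG_add, satG_singleton, satLit_eqn] at this
    exact this.elim hC hw
  · rintro h E' hE'
    obtain ⟨C', D', hC', hD', rfl⟩ := isGClause_add.1 hE'
    obtain ⟨L', hL', rfl⟩ := isGClause_singleton.1 hD'
    obtain ⟨w, rfl⟩ := isGLiteral_eqn.1 hL'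
    rw [satG_add, satG_singleton, satLit_eqn]
    exact (h C' hC').imp_right fun h => h w

theorem sat_add_neqn {C : Clause α} {s t : List α} :
    I.Sat (C + {neqn s t}) ↔ ∀ C', IsGClause C C' → I.SatG C' ∨ ¬ I.rel s t := by
  constructor
  · intro h C' hC'
    have := h (C' + {neqn (gterm s) (gterm t)})
      (isGClause_add.2 ⟨_, _, hC', isGClause_singleton.2 ⟨_, .neg s t, rfl⟩, rfl⟩)
    rwa [satG_add, satG_singleton, satLit_neqn] at this
  · rintro h E' hE'
    obtain ⟨C', D', hC', hD', rfl⟩ := isGClause_add.1 hE'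
    obtain ⟨L', hL', rfl⟩ := isGClause_singleton.1 hD'
    obtain rfl := isGLiteral_neqn.1 hL'
    rw [satG_add, satG_singleton, satLit_neqn]
    exact h C' hC'

theorem sat_eqn {s t : List α} : I.Sat {eqn s t} ↔ ∀ w, I.rel (s ++ w) (t ++ w) := by
  rw [← zero_add {eqn s t}, sat_add_eqn]
  constructor
  · intro h
    refine (h 0 Multiset.Rel.zero).resolve_left ?_
    simp [SatG]
  · exact fun h _ _ => Or.inr h

/-- The inferences are sound. -/
theorem sat_of_infers [LT α] {Ps : List (MarkedClause α)} {D : Clause α} (h : Infers Ps D)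
    (hPs : ∀ P ∈ Ps, I.Sat P.1) : I.Sat D := by
  have tr {a b c} := @I.equiv.trans a b c
  have sy {a b} := @I.equiv.symm a b
  cases h with
  | superposition C D σ τ u₁ u₂ u₃ s t =>
    have h₁ := I.sat_add_eqn.1 (hPs (C + {eqn (u₁ ++ u₂) s}, σ) (by simp))
    have h₂ := I.sat_add_eqn.1 (hPs (D + {eqn (u₂ ++ u₃) t}, τ) (by simp))
    refine I.sat_add_eqn.2 fun E' hE' => ?_
    obtain ⟨C', D', hC', hD', rfl⟩ := isGClause_add.1 hE'
    rw [satG_add]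
    rcases h₁ C' hC' with h₁ | h₁
    · exact Or.inl (Or.inl h₁)
    rcases h₂ D' hD' with h₂ | h₂
    · exact Or.inl (Or.inr h₂)
    refine Or.inr fun w => ?_
    have h₁ := h₁ (u₃ ++ w)
    have h₂ := I.rel_append_left (h₂ w) u₁
    simp only [List.append_assoc] at h₁ h₂ ⊢
    exact tr (sy h₂) h₁
  | rewritePos C D σ τ u₁ u₂ u₃ s t =>
    have h₁ := I.sat_add_eqn.1 (hPs (C + {eqn (u₁ ++ u₂ ++ u₃) s}, σ) (by simp))
    have h₂ := I.sat_add_eqn.1 (hPs (D + {eqn u₂ t}, τ) (by simp))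
    refine I.sat_add_eqn.2 fun E' hE' => ?_
    obtain ⟨C', D', hC', hD', rfl⟩ := isGClause_add.1 hE'
    rw [satG_add]
    rcases h₁ C' hC' with h₁ | h₁
    · exact Or.inl (Or.inl h₁)
    rcases h₂ D' hD' with h₂ | h₂
    · exact Or.inl (Or.inr h₂)
    refine Or.inr fun w => ?_
    have h₁ := h₁ w
    have h₂ := I.rel_append_left (h₂ (u₃ ++ w)) u₁
    simp only [List.append_assoc] at h₁ h₂ ⊢
    exact tr (sy h₂) h₁
  | rewriteNeg C D σ τ u₁ u₂ u₃ s t =>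
    have h₁ := I.sat_add_neqn.1 (hPs (C + {neqn (u₁ ++ u₂ ++ u₃) s}, σ) (by simp))
    have h₂ := I.sat_add_eqn.1 (hPs (D + {eqn u₂ t}, τ) (by simp))
    refine I.sat_add_neqn.2 fun E' hE' => ?_
    obtain ⟨C', D', hC', hD', rfl⟩ := isGClause_add.1 hE'
    rw [satG_add]
    rcases h₁ C' hC' with h₁ | h₁
    · exact Or.inl (Or.inl h₁)
    rcases h₂ D' hD' with h₂ | h₂
    · exact Or.inl (Or.inr h₂)
    refine Or.inr fun hr => h₁ ?_
    have h₂ := I.rel_append_left (h₂ u₃) u₁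
    simp only [List.append_assoc] at hr h₂ ⊢
    exact tr h₂ hr
  | equalityResolution _ σ s =>
    have h₁ := I.sat_add_neqn.1 (hPs (D + {neqn s s}, σ) (by simp))
    exact fun C' hC' => (h₁ C' hC').resolve_right fun h => h (I.equiv.refl s)
  | paramodulation C D σ τ u₁ u₂ u₃ s t =>
    have h₁ := I.sat_add_eqn.1 (hPs (C + {eqn s (u₁ ++ u₂)}, σ) (by simp))
    have h₂ := I.sat_add_eqn.1 (hPs (D + {eqn (u₂ ++ u₃) t}, τ) (by simp))
    refine I.sat_add_eqn.2 fun E' hE' => ?_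
    obtain ⟨C', D', hC', hD', rfl⟩ := isGClause_add.1 hE'
    rw [satG_add]
    rcases h₁ C' hC' with h₁ | h₁
    · exact Or.inl (Or.inl h₁)
    rcases h₂ D' hD' with h₂ | h₂
    · exact Or.inl (Or.inr h₂)
    refine Or.inr fun w => ?_
    have h₁ := h₁ (u₃ ++ w)
    have h₂ := I.rel_append_left (h₂ w) u₁
    simp only [List.append_assoc] at h₁ h₂ ⊢
    exact tr h₁ h₂
  | factoring C σ s t u =>
    have h₁ := I.sat_add_eqn.1
      (hPs (C + {eqn s t} + {eqn (s ++ u) (t ++ u)}, σ) (by simp))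
    refine I.sat_add_eqn.2 fun C' hC' => ?_
    by_contra! hcon
    obtain ⟨hC, w, hw⟩ := hcon
    -- With `u ++ w` appended, the shorter equation has the same ground instance as the longer one
    -- with `w`.
    have := h₁ (C' + {eqn (gterm (s ++ (u ++ w))) (gterm (t ++ (u ++ w)))})
      (isGClause_add.2 ⟨_, _, hC', isGClause_singleton.2 ⟨_, .pos s t (u ++ w), rfl⟩, rfl⟩)
    rw [satG_add, satG_singleton, satLit_eqn] at this
    simp only [List.append_assoc] at this hw
    rcases this with (h | h) | h
    · exact hC h
    · exact hw h
    · exact hw (h w)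

/-- Simplification is sound. -/
theorem sat_of_simplifies [LT α] {f : Selection α} {D D' : Clause α} {l r : List α}
    (h : Simplifies f D l r D') (hD : I.Sat D) (hlr : I.Sat {eqn l r}) : I.Sat D' := by
  rw [sat_eqn] at hlr
  cases h with
  | pos C l₁ _ l₂ _ v =>
    rw [sat_add_eqn] at hD ⊢
    refine fun C' hC' => (hD C' hC').imp_right fun h w => ?_
    have h₁ := h w
    have h₂ := I.rel_append_left (hlr (l₂ ++ w)) l₁
    simp only [List.append_assoc] at h₁ h₂ ⊢
    exact I.equiv.trans (I.equiv.symm h₂) h₁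
  | neg C l₁ _ l₂ _ v =>
    rw [sat_add_neqn] at hD ⊢
    refine fun C' hC' => (hD C' hC').imp_right fun h hr => h ?_
    have h₂ := I.rel_append_left (hlr l₂) l₁
    simp only [List.append_assoc] at hr h₂ ⊢
    exact I.equiv.trans h₂ hr

end Interp

/-! ## Clauses with exactly one positive literal -/

instance {β : Type*} : DecidablePred (Literal.IsPos : Literal β → Prop)
  | .pos _ => isTrue trivial
  | .neg _ => isFalse id

/-- The clause has exactly one positive literal. -/
def IsDefinite {β : Type*} (C : Clause β) : Prop := C.countP Literal.IsPos = 1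

theorem isPos_eqn {β : Type*} (s t : List β) : (eqn s t).IsPos := trivial

theorem not_isPos_neqn {β : Type*} (s t : List β) : ¬ (neqn s t).IsPos := id

theorem countP_eqn {β : Type*} (s t : List β) :
    ({eqn s t} : Clause β).countP Literal.IsPos = 1 := by
  rw [← Multiset.cons_zero, Multiset.countP_cons_of_pos _ (isPos_eqn s t), Multiset.countP_zero]

theorem countP_neqn {β : Type*} (s t : List β) :
    ({neqn s t} : Clause β).countP Literal.IsPos = 0 := by
  rw [← Multiset.cons_zero, Multiset.countP_cons_of_neg _ (not_isPos_neqn s t),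
    Multiset.countP_zero]

theorem IsConditionalEquation.isDefinite {C : Clause α} (h : IsConditionalEquation C) :
    IsDefinite C := by
  obtain ⟨Γ, l, r, hΓ, rfl⟩ := h
  rw [IsDefinite, Multiset.countP_add, countP_eqn, Multiset.countP_eq_zero.2]
  rintro (e | e) hL
  · exact absurd (hΓ _ hL) id
  · exact id

/-- A count of positive literals settles each rule; a premise of Factoring would have at least two.
-/
theorem isDefinite_of_infers {β : Type*} [LT β] {Ps : List (MarkedClause β)} {D : Clause β}
    (h : Infers Ps D) (hPs : ∀ P ∈ Ps, IsDefinite P.1) : IsDefinite D := by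
  cases h <;>
    simp only [List.mem_cons, List.not_mem_nil, or_false, forall_eq_or_imp, forall_eq,
      IsDefinite, Multiset.countP_add, countP_eqn, countP_neqn] at hPs ⊢ <;> omega

theorem isDefinite_of_simplifies [LT α] {f : Selection α} {D D' : Clause α} {l r : List α}
    (h : Simplifies f D l r D') (hD : IsDefinite D) : IsDefinite D' := by
  cases h <;>
    simpa only [IsDefinite, Multiset.countP_add, countP_eqn, countP_neqn] using hD

/-! ## Derivations -/

section Derivation

variable [LT α] {f : Selection α} {S : ℕ → Set (Clause α)}

/-- All clauses in a derivation from a conditional equational theory are consequences of it and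
have exactly one positive literal. -/
theorem IsDerivation.entails_and_isDefinite (hS : IsDerivation f S)
    (h₀ : ∀ C ∈ S 0, IsConditionalEquation C) (i : ℕ) :
    ∀ C ∈ S i, Entails (S 0) C ∧ IsDefinite C := by
  induction i with
  | zero => exact fun C hC => ⟨fun I hI => hI C hC, (h₀ C hC).isDefinite⟩
  | succ i ih =>
    have hstep := hS i
    generalize S (i + 1) = S' at hstep
    cases hstep with
    | deduce Ps D hPs hinf =>
      rintro C (hC | rfl)
      · exact ih C hC
      · refine ⟨fun I hI => I.sat_of_infers hinf fun P hP => ?_,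
          isDefinite_of_infers hinf fun P hP => ?_⟩
        · obtain ⟨K, hK, rfl⟩ := List.mem_map.1 hP
          exact (ih K (hPs K hK)).1 I hI
        · obtain ⟨K, hK, rfl⟩ := List.mem_map.1 hP
          exact (ih K (hPs K hK)).2
    | simplify D D' l r hD hlr hs =>
      rintro C (hC | rfl)
      · exact ih C hC
      · exact ⟨fun I hI => I.sat_of_simplifies hs ((ih _ hD).1 I hI) ((ih _ hlr).1 I hI),
          isDefinite_of_simplifies hs (ih _ hD).2⟩
    | delete D => exact fun C hC => ih C hC.1
    | idle => exact ih

/-- A clause that does not persist is redundant. -/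
theorem IsDerivation.redundantClause (hS : IsDerivation f S) {K : Clause α} (hK : K ∈ ⋃ j, S j)
    (hK' : K ∉ limitSet S) : RedundantClause (⋃ j, S j) K := by
  obtain ⟨i, hi⟩ := Set.mem_iUnion.1 hK
  have hex : ∃ n, K ∉ S (i + n) := by
    by_contra! hcon
    refine hK' (Set.mem_iUnion.2 ⟨i, Set.mem_iInter₂.2 fun j hj => ?_⟩)
    obtain ⟨n, rfl⟩ := Nat.exists_eq_add_of_le hj
    exact hcon n
  obtain ⟨k, hk, hk'⟩ : ∃ k, K ∈ S k ∧ K ∉ S (k + 1) := by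
    by_contra! hcon
    obtain ⟨n, hn⟩ := hex
    refine hn ?_
    clear hn
    induction n with
    | zero => exact hi
    | succ n ih => exact hcon _ ih
  have hred : RedundantClause (S k) K := by
    have hstep := hS k
    generalize S (k + 1) = S' at hstep hk'
    cases hstep with
    | deduce => exact absurd (Or.inl hk) hk'
    | simplify => exact absurd (Or.inl hk) hk'
    | delete D hD =>
      by_cases hKD : K = D
      · exact hKD ▸ hD
      · exact absurd ⟨hk, hKD⟩ hk'
    | idle => exact absurd hk hk'
  -- Redundancy at the stage of deletion carries over to the union, since it is monotone in the set
  -- of clauses.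
  intro C' hC'
  obtain ⟨N, hN, hN', hent⟩ := hred C' hC'
  exact ⟨N, hN, fun K' hK' => ⟨(hN' K' hK').1.imp fun K h =>
    ⟨Set.mem_iUnion.2 ⟨k, h.1⟩, h.2⟩, (hN' K' hK').2⟩, hent⟩

end Derivation

end Ground

/-! ## Newman's lemma -/

section Newman

open Relation

variable {X : Type*} {r : X → X → Prop}

theorem join_of_locallyConfluent (hwf : WellFounded (fun x y => r y x))
    (hlc : ∀ a b c, r a b → r a c → Join (ReflTransGen r) b c) {a b c : X}
    (hab : ReflTransGen r a b) (hac : ReflTransGen r a c) : Join (ReflTransGen r) b c := by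
  induction a using hwf.induction generalizing b c with
  | _ a ih =>
    rcases ReflTransGen.cases_head hab with rfl | ⟨b', hab', hb'⟩
    · exact ⟨c, hac, .refl⟩
    rcases ReflTransGen.cases_head hac with rfl | ⟨c', hac', hc'⟩
    · exact ⟨b, .refl, hab⟩
    obtain ⟨d, hbd, hcd⟩ := hlc _ _ _ hab' hac'
    obtain ⟨e, hbe, hde⟩ := ih b' hab' hb' hbd
    obtain ⟨g, heg, hcg⟩ := ih c' hac' (hcd.trans hde) hc'
    exact ⟨g, hbe.trans heg, hcg⟩

/-- The Church–Rosser property; only transitivity has content, where confluence at the middle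
element connects the two joins. -/
theorem join_of_eqvGen (hwf : WellFounded (fun x y => r y x))
    (hlc : ∀ a b c, r a b → r a c → Join (ReflTransGen r) b c) {a b : X}
    (hab : EqvGen r a b) : Join (ReflTransGen r) a b := by
  induction hab with
  | rel _ y h => exact ⟨y, .single h, .refl⟩
  | refl x => exact ⟨x, .refl, .refl⟩
  | symm _ _ _ ih =>
    obtain ⟨z, h₁, h₂⟩ := ih
    exact ⟨z, h₂, h₁⟩
  | trans _ _ _ _ _ ih₁ ih₂ =>
    obtain ⟨d, hxd, hyd⟩ := ih₁
    obtain ⟨e, hye, hze⟩ := ih₂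
    obtain ⟨g, hdg, heg⟩ := join_of_locallyConfluent hwf hlc hyd hye
    exact ⟨g, hxd.trans hdg, hze.trans heg⟩

theorem eqvGen_of_reflTransGen {a b : X} (h : ReflTransGen r a b) : EqvGen r a b := by
  induction h with
  | refl => exact .refl _
  | tail _ h ih => exact ih.trans _ _ _ (.rel _ _ h)

theorem eqvGen_of_join {a b : X} (h : Join (ReflTransGen r) a b) : EqvGen r a b := by
  obtain ⟨c, hac, hbc⟩ := h
  exact (eqvGen_of_reflTransGen hac).trans _ _ _ (eqvGen_of_reflTransGen hbc).symm

end Newman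

/-! ## Ground rewriting by unit clauses -/

section Rewriting

open Relation

variable {α : Type*} [LinearOrder α] {M : Set (Clause α)} {Q Q' : Set (Clause (WithBot α))}

/-- The ground rule `p → q` is an instance of an equation in `M`, and it belongs to `Q`. -/
def GRule (M : Set (Clause α)) (Q : Set (Clause (WithBot α))) (p q : List α) : Prop :=
  ∃ l r w, {eqn l r} ∈ M ∧ StrGT l r ∧ p = l ++ w ∧ q = r ++ w ∧ {eqn (gterm p) (gterm q)} ∈ Q

/-- Rewriting with ground rules, below a prefix. -/
def Rew (M : Set (Clause α)) (Q : Set (Clause (WithBot α))) (x y : List α) : Prop :=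
  ∃ u p q, GRule M Q p q ∧ x = u ++ p ∧ y = u ++ q

theorem GRule.gt {p q : List α} (h : GRule M Q p q) : StrGT p q := by
  obtain ⟨l, r, w, -, hlr, rfl, rfl, -⟩ := h
  exact hlr.append [] w

theorem GRule.rew {p q : List α} (h : GRule M Q p q) (u : List α) :
    Rew M Q (u ++ p) (u ++ q) := ⟨u, p, q, h, rfl, rfl⟩

theorem GRule.mem {p q : List α} (h : GRule M Q p q) : {eqn (gterm p) (gterm q)} ∈ Q := by
  obtain ⟨_, _, _, _, _, _, _, h⟩ := h
  exact h

theorem GRule.of_mem {p q : List α} (h : GRule M Q p q)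
    (h' : {eqn (gterm p) (gterm q)} ∈ Q') : GRule M Q' p q := by
  obtain ⟨l, r, w, h₁, h₂, h₃, h₄, -⟩ := h
  exact ⟨l, r, w, h₁, h₂, h₃, h₄, h'⟩

theorem Rew.gt {x y : List α} (h : Rew M Q x y) : StrGT x y := by
  obtain ⟨u, p, q, h, rfl, rfl⟩ := h
  simpa using h.gt.append u []

theorem Rew.mono (hQ : Q ⊆ Q') {x y : List α} (h : Rew M Q x y) : Rew M Q' x y := by
  obtain ⟨u, p, q, h, rfl, rfl⟩ := h
  exact (h.of_mem (hQ h.mem)).rew u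

/-- Closure holds under prefixes only: a ground rule reaches to the end of the string, and its tail
is part of what membership in `Q` restricts. -/
theorem Rew.append_left {x y : List α} (h : Rew M Q x y) (v : List α) :
    Rew M Q (v ++ x) (v ++ y) := by
  obtain ⟨u, p, q, h, rfl, rfl⟩ := h
  simpa using h.rew (v ++ u)

theorem wellFounded_rew [WellFoundedLT α] : WellFounded (fun x y => Rew M Q y x) :=
  Subrelation.wf (fun h => h.gt) wellFounded_strGT

/-- The interpretation generated by the equations in `M` whose ground instances belong to `Q`. -/
def model (M : Set (Clause α)) (Q : Set (Clause (WithBot α))) : Interp α where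
  rel := EqvGen (Rew M Q)
  equiv := EqvGen.is_equivalence _
  congr a u v h := by
    induction h with
    | rel _ _ h => exact .rel _ _ (h.append_left [a])
    | refl => exact .refl _
    | symm _ _ _ ih => exact ih.symm
    | trans _ _ _ _ _ ih₁ ih₂ => exact ih₁.trans _ _ _ ih₂

theorem model_rel_mono (hQ : Q ⊆ Q') {x y : List α} (h : (model M Q).rel x y) :
    (model M Q').rel x y := 
  EqvGen.mono (r := Rew M Q) (fun _ _ => Rew.mono hQ) _ _ h

/-- All critical pairs between ground rules are joinable. -/
def CriticalPairsJoin (M : Set (Clause α)) (Q : Set (Clause (WithBot α))) : Prop :=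
  ∀ u p q p' q', GRule M Q p q → GRule M Q p' q' → p = u ++ p' →
    Join (ReflTransGen (Rew M Q)) q (u ++ q')

theorem join_append_left {x y : List α} (h : Join (ReflTransGen (Rew M Q)) x y) (v : List α) :
    Join (ReflTransGen (Rew M Q)) (v ++ x) (v ++ y) := by
  obtain ⟨z, h₁, h₂⟩ := h
  exact ⟨v ++ z, h₁.lift (v ++ ·) fun _ _ h => h.append_left v,
    h₂.lift (v ++ ·) fun _ _ h => h.append_left v⟩

/-- Ground rules rewrite suffixes, so of two redexes in a string one is a suffix of the other. Local
confluence therefore reduces to critical pairs, and Newman's lemma applies. -/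
theorem CriticalPairsJoin.join [WellFoundedLT α] (h : CriticalPairsJoin M Q) {x y : List α}
    (hxy : (model M Q).rel x y) : Join (ReflTransGen (Rew M Q)) x y := by
  refine join_of_eqvGen wellFounded_rew ?_ hxy
  rintro _ _ _ ⟨u, p, q, hpq, rfl, rfl⟩ ⟨u', p', q', hpq', he, rfl⟩
  rcases List.append_eq_append_iff.1 he with ⟨a, rfl, rfl⟩ | ⟨a, rfl, rfl⟩
  · rw [List.append_assoc]
    exact join_append_left (h a _ _ _ _ hpq hpq' rfl) u
  · rw [List.append_assoc]
    obtain ⟨z, h₁, h₂⟩ := join_append_left (h a _ _ _ _ hpq' hpq rfl) u'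
    exact ⟨z, h₂, h₁⟩

/-- The ground clauses of clauses in `M` that belong to `Q` are true in the interpretation
generated by `M` and `Q`. -/
def GClausesTrue (M : Set (Clause α)) (Q : Set (Clause (WithBot α))) : Prop :=
  ∀ K ∈ M, ∀ G, IsGClause K G → G ∈ Q → (model M Q).SatG G

/-- The ground clauses below `B`. -/
def below (B : Clause (WithBot α)) : Set (Clause (WithBot α)) := {K | ClauseGT B K}

/-- `Q` is closed under smaller clauses. -/
def IsLower (Q : Set (Clause (WithBot α))) : Prop := ∀ B ∈ Q, below B ⊆ Q

theorem isLower_below (B : Clause (WithBot α)) : IsLower (below B) :=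
  fun _ hC _ hD => strictTotal_clauseGT.trans _ _ _ hC hD

/-- An interpretation in which the ground clauses in `Q` of nonredundant clauses are true
satisfies all ground clauses in `Q`. -/
theorem satG_of_redundant [Finite α] {T : Set (Clause α)}
    (hred : ∀ K ∈ T, K ∉ M → RedundantClause T K) (hQ : IsLower Q) {I : Interp α}
    (hM : ∀ K ∈ M, ∀ K', IsGClause K K' → K' ∈ Q → I.SatG K') {K : Clause α} (hK : K ∈ T)
    {K' : Clause (WithBot α)} (hK' : IsGClause K K') (hK'Q : K' ∈ Q) : I.SatG K' := by
  induction K' using (wellFounded_clauseGT (β := WithBot α)).induction generalizing K with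
  | _ K' ih =>
    by_cases hKM : K ∈ M
    · exact hM K hKM K' hK' hK'Q
    · obtain ⟨N, -, hN, hent⟩ := hred K hK hKM K' hK'
      refine hent I fun L' hL' => ?_
      obtain ⟨⟨L, hL, hLL'⟩, hgt⟩ := hN L' hL'
      exact ih L' hgt hL hLL' (hQ _ hK'Q hgt)

/-- This is how redundancy is used: the entailing ground clauses lie below `B'` and hence are true
in the model below `B'`, even if they come from clauses outside `M`. -/
theorem satG_of_followsBelow [Finite α] {T : Set (Clause α)}
    (hred : ∀ K ∈ T, K ∉ M → RedundantClause T K) {B' D' : Clause (WithBot α)}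
    (hM : GClausesTrue M (below B')) (h : FollowsBelow T B' D') :
    (model M (below B')).SatG D' := by
  obtain ⟨N, -, hN, hent⟩ := h
  refine hent _ fun L' hL' => ?_
  obtain ⟨⟨L, hL, hLL'⟩, hgt⟩ := hN L' hL'
  exact satG_of_redundant hred (isLower_below B') hM hL hLL' hgt

end Rewriting

/-! ## Saturated sets -/

section Saturation

open Relation

variable {α : Type*}

theorem Selection.sel_eqn (f : Selection α) (s t : List α) : f.sel {eqn s t} = none := by
  rw [Option.eq_none_iff_forall_not_mem]
  intro L hL
  obtain ⟨h₁, h₂⟩ := f.sel_mem _ _ hL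
  rw [Multiset.mem_singleton.1 h₁] at h₂
  exact h₂

theorem noSelected_zero {β : Type*} (σ : Option (Literal β)) : NoSelected σ 0 :=
  fun L hL => absurd hL (Multiset.notMem_zero L)

theorem IsDefinite.eq_eqn {K : Clause α} (h : IsDefinite K) (hneg : ∀ L ∈ K, ¬ L.IsNeg) :
    ∃ l r, K = {eqn l r} := by
  have hall : ∀ L ∈ K, L.IsPos := by
    rintro (e | e) hL
    · trivial
    · exact absurd trivial (hneg _ hL)
  rw [IsDefinite, Multiset.countP_eq_card.2 hall] at h
  obtain ⟨L, rfl⟩ := Multiset.card_eq_one.1 h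
  rcases L with e | e
  · induction e using Sym2.ind with
    | _ l r => exact ⟨l, r, rfl⟩
  · exact absurd trivial (hneg (.neg e) (by simp))

variable [LinearOrder α] {f : Selection α} {M T : Set (Clause α)} {Q : Set (Clause (WithBot α))}

/-- Two equations whose left-hand sides overlap have a critical pair. -/
theorem exists_inference_of_overlap {l r l' r' u a w w' : List α} (hlr : StrGT l r)
    (hlr' : StrGT l' r') (ha : a ≠ []) (hl : l = u ++ a) (he : l' ++ w' = a ++ w) :
    ∃ D, IsInference f [{eqn l r}, {eqn l' r'}] D ∧
      IsGClause D {eqn (gterm (u ++ (r' ++ w'))) (gterm (r ++ w))} := by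
  subst hl
  -- Either `l'` lies inside `l`, which gives a Rewrite, or it may extend beyond the end of `l`,
  -- which gives a Superposition.
  rcases List.append_eq_append_iff.1 he with ⟨b, rfl, rfl⟩ | ⟨b, rfl, rfl⟩
  · refine ⟨{eqn (u ++ r' ++ b) r}, ?_, isGClause_singleton.2 ⟨_, .pos _ _ w, by simp⟩⟩
    have := Infers.rewritePos 0 0 none none u l' b r r' (noSelected_zero _)
      (noSelected_zero _) hlr'
    simpa [IsInference, f.sel_eqn] using this
  · refine ⟨{eqn (u ++ r') (r ++ b)}, ?_, isGClause_singleton.2 ⟨_, .pos _ _ w', by simp⟩⟩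
    have := Infers.superposition 0 0 none none u a b r r' ha (noSelected_zero _)
      (noSelected_zero _) hlr hlr'
    simpa [IsInference, f.sel_eqn] using this

/-- Both left-hand sides end in `⊥`, so either kind of overlap becomes a ground Superposition with
empty `u₃`. A g-instance does not have to use the same rule as the inference on strings. -/
theorem infers_ground_superposition {u p' q q' : List α} (h : StrGT (u ++ p') q)
    (h' : StrGT p' q') :
    Infers [({eqn (gterm (u ++ p')) (gterm q)}, none), ({eqn (gterm p') (gterm q')}, none)]
      {eqn (gterm (u ++ q')) (gterm q)} := by
  have := Infers.superposition 0 0 none none (u.map WithBot.some) (gterm p') [] (gterm q)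
    (gterm q') (by simp [gterm_eq]) (noSelected_zero _) (noSelected_zero _)
    (by simpa only [gterm_append] using h.gterm) (by simpa only [List.append_nil] using h'.gterm)
  simpa [gterm_append] using this

/-- The sets of clauses that arise as limits of fair derivations from conditional equational
theories. -/
structure Saturated (f : Selection α) (T M : Set (Clause α)) : Prop where
  redundantInference : ∀ Ps D, (∀ P ∈ Ps, P ∈ M) → IsInference f Ps D →
    RedundantInference f T Ps D
  redundantClause : ∀ K ∈ T, K ∉ M → RedundantClause T K
  isDefinite : ∀ K ∈ M, IsDefinite K

/-- Terms that are bounded by a side of a negative literal of `C'` are only rewritten by rules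
below `C'`. -/
theorem reflTransGen_below {C' : Clause (WithBot α)} {s t z : List α}
    (hL : neqn (gterm s) (gterm t) ∈ C') (h : ReflTransGen (Rew M Q) s z) :
    ReflTransGen (Rew M (below C')) s z := by
  have ht := strictTotal_strGT (β := α)
  suffices ReflTransGen (Rew M (below C')) s z ∧ (z = s ∨ StrGT s z) from this.1
  induction h with
  | refl => exact ⟨.refl, Or.inl rfl⟩
  | @tail x y _ hxy ih =>
    refine ⟨ih.1.tail ?_, Or.inr ?_⟩
    · obtain ⟨u, p, q, hpq, rfl, rfl⟩ := hxy
      refine (hpq.of_mem (clauseGT_singleton hL (litGT_neqn_eqn ?_ hpq.gt.gterm))).rew u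
      have hp : p = s ∨ StrGT s p := by
        cases u with
        | nil => exact ih.2
        | cons a u =>
          have hgt : StrGT (a :: u ++ p) p := List.Shortlex.of_length_lt (by simp)
          rcases ih.2 with h | h
          · exact Or.inr (h ▸ hgt)
          · exact Or.inr (ht.trans _ _ _ h hgt)
      exact hp.imp (congrArg gterm) StrGT.gterm
    · rcases ih.2 with rfl | h
      · exact hxy.gt
      · exact ht.trans _ _ _ h hxy.gt

theorem isLower_univ : IsLower (Set.univ : Set (Clause (WithBot α))) :=
  fun _ _ _ _ => trivial

variable [Finite α]

theorem Saturated.criticalPairsJoin (hM : Saturated f T M) (hQ : IsLower Q)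
    (ih : ∀ B ∈ Q, CriticalPairsJoin M (below B) ∧ GClausesTrue M (below B)) :
    CriticalPairsJoin M Q := by
  intro u p q p' q' hpq hpq' hp
  obtain ⟨l, r, w, hM₁, hlr, rfl, rfl, hQ₁⟩ := id hpq
  obtain ⟨l', r', w', hM₂, hlr', rfl, rfl, hQ₂⟩ := id hpq'
  have key : (∃ a, u = l ++ a ∧ w = a ++ (l' ++ w')) ∨
      ∃ a, a ≠ [] ∧ l = u ++ a ∧ l' ++ w' = a ++ w := by
    rcases List.append_eq_append_iff.1 hp with h | ⟨a, h₁, h₂⟩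
    · exact Or.inl h
    -- Redexes that merely touch count as disjoint, since Superposition needs a nonempty overlap.
    · by_cases ha : a = []
      · subst ha
        exact Or.inl ⟨[], by simpa using h₁.symm, by simpa using h₂.symm⟩
      · exact Or.inr ⟨a, ha, h₁, h₂⟩
  rcases key with ⟨a, rfl, rfl⟩ | ⟨a, ha, hl, he⟩
  · have hgt : StrGT (l ++ (a ++ (l' ++ w'))) (l ++ (a ++ (r' ++ w'))) := by
      simpa using hlr'.append (l ++ a) w'
    have hgt' : StrGT (l ++ (a ++ (r' ++ w'))) (r ++ (a ++ (r' ++ w'))) := by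
      simpa using hlr.append [] (a ++ (r' ++ w'))
    -- Without an overlap the two steps commute. The outer rule is then used with the rewritten
    -- tail; this smaller instance belongs to `Q` because `Q` is a lower set.
    have hrule : GRule M Q (l ++ (a ++ (r' ++ w'))) (r ++ (a ++ (r' ++ w'))) :=
      ⟨l, r, _, hM₁, hlr, rfl, rfl, hQ _ hQ₁ (clauseGT_singleton (Multiset.mem_singleton_self _)
        (litGT_eqn_eqn hgt.gterm hgt'.gterm))⟩
    refine ⟨r ++ (a ++ (r' ++ w')), .single ?_, .single ?_⟩
    · simpa using hpq'.rew (r ++ a)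
    · simpa using hrule.rew []
  · obtain ⟨D, hD, hD'⟩ := exists_inference_of_overlap (f := f) hlr hlr' ha hl he
    have hinf := infers_ground_superposition (hp ▸ hpq.gt) hpq'.gt
    rw [← hp] at hinf
    have hinst : IsGInstance f [{eqn l r}, {eqn l' r'}] D _ _ :=
      ⟨.cons ⟨isGClause_singleton.2 ⟨_, .pos l r w, rfl⟩, by rw [f.sel_eqn]; rfl⟩
        (.cons ⟨isGClause_singleton.2 ⟨_, .pos l' r' w', rfl⟩, by rw [f.sel_eqn]; rfl⟩ .nil),
        hD', hinf⟩
    have hred := hM.redundantInference _ _ (by simp [hM₁, hM₂]) hD _ _ hinst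
    -- `B` is a maximal premise, and both premises lie in `Q`, so the induction hypothesis applies
    -- to it.
    obtain ⟨B, hB, hfol⟩ : ∃ B ∈ Q, FollowsBelow T B
        {eqn (gterm (u ++ (r' ++ w'))) (gterm (r ++ w))} := by
      have hcl := strictTotal_clauseGT (β := WithBot α)
      by_cases hgt : ClauseGT {eqn (gterm (l' ++ w')) (gterm (r' ++ w'))}
        {eqn (gterm (l ++ w)) (gterm (r ++ w))}
      · refine ⟨_, hQ₂, hred _ (by simp) ?_⟩
        simp only [List.map_cons, List.map_nil, List.mem_cons, List.not_mem_nil, or_false,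
          forall_eq_or_imp, forall_eq]
        exact ⟨hcl.asymm hgt, hcl.irrefl _⟩
      · refine ⟨_, hQ₁, hred _ (by simp) ?_⟩
        simp only [List.map_cons, List.map_nil, List.mem_cons, List.not_mem_nil, or_false,
          forall_eq_or_imp, forall_eq]
        exact ⟨hcl.irrefl _, hgt⟩
    have hsat := satG_of_followsBelow hM.redundantClause (ih B hB).2 hfol
    rw [Interp.satG_singleton, Interp.satLit_eqn] at hsat
    obtain ⟨z, h₁, h₂⟩ := (ih B hB).1.join hsat
    exact ⟨z, ReflTransGen.mono (fun _ _ => Rew.mono (hQ B hB)) _ _ h₂,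
      ReflTransGen.mono (fun _ _ => Rew.mono (hQ B hB)) _ _ h₁⟩

/-- If one side of the selected literal is reducible, then the clause is true. -/
theorem Saturated.satG_of_rew (hM : Saturated f T M) {C : Clause α} {C' : Clause (WithBot α)}
    {s t s' : List α} (hK : C + {neqn s t} ∈ M) (hsel : f.sel (C + {neqn s t}) = some (neqn s t))
    (hC : IsGClause C C') (ih : GClausesTrue M (below (C' + {neqn (gterm s) (gterm t)})))
    (hrew : Rew M (below (C' + {neqn (gterm s) (gterm t)})) s s')
    (hst : (model M (below (C' + {neqn (gterm s) (gterm t)}))).rel s t) :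
    (model M (below (C' + {neqn (gterm s) (gterm t)}))).SatG C' := by
  have hss' := EqvGen.rel _ _ hrew
  obtain ⟨u, p, q, hpq, rfl, rfl⟩ := hrew
  obtain ⟨l, r, w, hlrM, hlr, rfl, rfl, hgt⟩ := id hpq
  have hcl := strictTotal_clauseGT (β := WithBot α)
  have hinf : IsInference f [C + {neqn (u ++ (l ++ w)) t}, {eqn l r}]
      (C + {neqn (u ++ (r ++ w)) t}) := by
    have := Infers.rewriteNeg C 0 (some (neqn (u ++ (l ++ w)) t)) none u l w t r (by simp)
      (noSelected_zero _) hlr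
    simpa [IsInference, f.sel_eqn, hsel] using this
  have hinf' : Infers [(C' + {neqn (gterm (u ++ (l ++ w))) (gterm t)},
        some (neqn (gterm (u ++ (l ++ w))) (gterm t))),
      ({eqn (gterm (l ++ w)) (gterm (r ++ w))}, none)]
      (C' + {neqn (gterm (u ++ (r ++ w))) (gterm t)}) := by
    have := Infers.rewriteNeg C' 0 (some (neqn (gterm (u ++ (l ++ w))) (gterm t))) none
      (u.map WithBot.some) (gterm (l ++ w)) [] (gterm t) (gterm (r ++ w))
      (by rw [gterm_append u, List.append_nil]) (noSelected_zero _) hpq.gt.gterm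
    simpa only [gterm_append u, List.append_nil, zero_add, add_zero] using this
  -- The rule comes from below the clause (`hgt`), so the clause itself is the maximal premise.
  have hfol := hM.redundantInference _ _ (by simp [hK, hlrM]) hinf _ _
    ⟨.cons ⟨isGClause_add.2 ⟨_, _, hC, isGClause_singleton.2 ⟨_, .neg _ _, rfl⟩, rfl⟩,
        by rw [hsel]; rfl⟩
      (.cons ⟨isGClause_singleton.2 ⟨_, .pos l r w, rfl⟩, by rw [f.sel_eqn]; rfl⟩ .nil),
      isGClause_add.2 ⟨_, _, hC, isGClause_singleton.2 ⟨_, .neg _ _, rfl⟩, rfl⟩, hinf'⟩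
    (C' + {neqn (gterm (u ++ (l ++ w))) (gterm t)}) (by simp) (by
      simp only [List.map_cons, List.map_nil, List.mem_cons, List.not_mem_nil, or_false,
        forall_eq_or_imp, forall_eq]
      exact ⟨hcl.irrefl _, hcl.asymm hgt⟩)
  have hsat := satG_of_followsBelow hM.redundantClause ih hfol
  rw [Interp.satG_add, Interp.satG_singleton, Interp.satLit_neqn] at hsat
  -- The rewritten negative literal is false, because the rewrite step preserves the equality with
  -- `t`.
  exact hsat.resolve_right fun h => h (hss'.symm.trans _ _ _ hst)

/-- A ground clause of a saturated set is true in the interpretation generated by the smaller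
ground clauses, unless it is a ground equation. -/
theorem Saturated.satG_below (hM : Saturated f T M) {K : Clause α} {K' : Clause (WithBot α)}
    {L : Literal α} (hK : K ∈ M) (hsel : f.sel K = some L) (hK' : IsGClause K K')
    (ih : CriticalPairsJoin M (below K') ∧ GClausesTrue M (below K')) :
    (model M (below K')).SatG K' := by
  obtain ⟨hLK, hL⟩ := f.sel_mem _ _ hsel
  obtain ⟨C, rfl⟩ := Multiset.exists_cons_of_mem hLK
  rcases L with e | e
  · exact hL.elim
  induction e using Sym2.ind with
  | _ s t =>
    rw [← Multiset.singleton_add, add_comm] at hK hsel hK'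
    change C + {neqn s t} ∈ M at hK
    change f.sel (C + {neqn s t}) = some (neqn s t) at hsel
    change IsGClause (C + {neqn s t}) K' at hK'
    obtain ⟨C', D', hC, hD, rfl⟩ := isGClause_add.1 hK'
    obtain ⟨L', hL', rfl⟩ := isGClause_singleton.1 hD
    obtain rfl := isGLiteral_neqn.1 hL'
    rw [Interp.satG_add, Interp.satG_singleton, Interp.satLit_neqn]
    refine or_iff_not_imp_right.2 fun hst => ?_
    rw [not_not] at hst
    by_cases hne : s = t
    · subst hne
      have hfol := hM.redundantInference [C + {neqn s s}] C (by simpa using hK)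
        (.equalityResolution C _ s hsel) [(C' + {neqn (gterm s) (gterm s)}, _)] C'
        ⟨.cons ⟨hK', rfl⟩ .nil, hC, .equalityResolution C' _ (gterm s) (by rw [hsel]; rfl)⟩
        (C' + {neqn (gterm s) (gterm s)}) (by simp)
        (by simpa using strictTotal_clauseGT.irrefl _)
      exact satG_of_followsBelow hM.redundantClause ih.2 hfol
    · obtain ⟨z, hs, ht⟩ := ih.1.join hst
      rcases ReflTransGen.cases_head hs with rfl | ⟨s', hss, -⟩
      · rcases ReflTransGen.cases_head ht with rfl | ⟨t', ht', -⟩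
        · exact absurd rfl hne
        · rw [neqn_comm] at hK
          rw [neqn_comm s t] at hsel
          rw [neqn_comm (gterm s)] at ih ht' hst ⊢
          exact hM.satG_of_rew hK hsel hC ih.2 ht' ((Interp.equiv _).symm hst)
      · exact hM.satG_of_rew hK hsel hC ih.2 hss hst

/-- Truth of a ground clause persists when larger rules are added. -/
theorem CriticalPairsJoin.satG (hcp : CriticalPairsJoin M Q) {K : Clause α}
    {K' : Clause (WithBot α)} (hK' : IsGClause K K') (hsub : below K' ⊆ Q)
    (h : (model M (below K')).SatG K') : (model M Q).SatG K' := by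
  obtain ⟨L', hL', hsat⟩ := h
  refine ⟨L', hL', ?_⟩
  obtain ⟨L, -, hLL'⟩ := Multiset.exists_mem_of_rel_of_mem (Multiset.rel_flip.2 hK') hL'
  cases hLL' with
  | pos s t w =>
    rw [Interp.satLit_eqn] at hsat ⊢
    exact model_rel_mono hsub hsat
  | neg s t =>
    rw [Interp.satLit_neqn] at hsat ⊢
    -- Confluence is essential here: an arbitrary chain of equalities in the larger model may use
    -- large rules, whereas a join only descends from `s` and `t`.
    refine fun hst => hsat (eqvGen_of_join ?_)
    obtain ⟨z, hs, ht⟩ := hcp.join hst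
    exact ⟨z, reflTransGen_below hL' hs, reflTransGen_below (neqn_comm _ _ ▸ hL') ht⟩

theorem Saturated.gClausesTrue (hM : Saturated f T M) (hQ : IsLower Q)
    (ih : ∀ B ∈ Q, CriticalPairsJoin M (below B) ∧ GClausesTrue M (below B)) :
    GClausesTrue M Q := by
  intro K hK K' hK' hK'Q
  cases hsel : f.sel K with
  | some L =>
    exact (hM.criticalPairsJoin hQ ih).satG hK' (hQ K' hK'Q)
      (hM.satG_below hK hsel hK' (ih K' hK'Q))
  | none =>
    -- Nothing selected means no negative literal, so a definite clause is a unit equation.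
    obtain ⟨l, r, rfl⟩ := (hM.isDefinite K hK).eq_eqn fun L hL hneg => by
      simpa [hsel] using f.sel_isSome K ⟨L, hL, hneg⟩
    obtain ⟨L', hL', rfl⟩ := isGClause_singleton.1 hK'
    obtain ⟨w, rfl⟩ := isGLiteral_eqn.1 hL'
    rw [Interp.satG_singleton, Interp.satLit_eqn]
    rcases strictTotal_strGT.total l r with hlr | rfl | hlr
    · have hrule : GRule M Q (l ++ w) (r ++ w) := ⟨l, r, w, hK, hlr, rfl, rfl, hK'Q⟩
      exact .rel _ _ (hrule.rew [])
    · exact .refl _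
    · rw [eqn_comm] at hK hK'Q
      have hrule : GRule M Q (r ++ w) (l ++ w) := ⟨r, l, w, hK, hlr, rfl, rfl, hK'Q⟩
      exact .symm _ _ (.rel _ _ (hrule.rew []))

theorem Saturated.below_invariant (hM : Saturated f T M) (B : Clause (WithBot α)) :
    CriticalPairsJoin M (below B) ∧ GClausesTrue M (below B) := by
  induction B using (wellFounded_clauseGT (β := WithBot α)).induction with
  | _ B ih =>
    exact ⟨hM.criticalPairsJoin (isLower_below B) fun C hC => ih C hC,
      hM.gClausesTrue (isLower_below B) fun C hC => ih C hC⟩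

/-- The equations of the limit of a fair derivation form a convergent rewrite system for the
initial theory. -/
theorem entails_iff_join {S : ℕ → Set (Clause α)} (h₀ : ∀ C ∈ S 0, IsConditionalEquation C)
    (hS : IsDerivation f S) (hfair : Fair f S) (s t : List α) :
    Entails (S 0) {eqn s t} ↔ Join (ReflTransGen (Rew (limitSet S) Set.univ)) s t := by
  have hlim : limitSet S ⊆ ⋃ j, S j := by
    intro K hK
    obtain ⟨i, hi⟩ := Set.mem_iUnion.1 hK
    exact Set.mem_iUnion.2 ⟨i, Set.mem_iInter₂.1 hi i le_rfl⟩
  have hT : ∀ K ∈ ⋃ j, S j, Entails (S 0) K ∧ IsDefinite K := by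
    intro K hK
    obtain ⟨i, hi⟩ := Set.mem_iUnion.1 hK
    exact hS.entails_and_isDefinite h₀ i K hi
  have hM : Saturated f (⋃ j, S j) (limitSet S) :=
    ⟨hfair, fun K hK hK' => hS.redundantClause hK hK', fun K hK => (hT K (hlim hK)).2⟩
  have hcp := hM.criticalPairsJoin isLower_univ fun B _ => hM.below_invariant B
  have htrue := hM.gClausesTrue isLower_univ fun B _ => hM.below_invariant B
  constructor
  · intro h
    -- The model satisfies the initial clauses, including the deleted ones, which are redundant.
    have hsat := h (model (limitSet S) Set.univ) fun K hK K' hK' =>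
      satG_of_redundant hM.redundantClause isLower_univ htrue (Set.mem_iUnion.2 ⟨0, hK⟩) hK'
        trivial
    have hst := (Interp.sat_eqn _).1 hsat []
    rw [List.append_nil, List.append_nil] at hst
    exact hcp.join hst
  · intro h I hI
    rw [Interp.sat_eqn]
    intro v
    replace h := eqvGen_of_join h
    induction h with
    | rel x y hxy =>
      obtain ⟨u, p, q, ⟨l, r, w, hlr, -, rfl, rfl, -⟩, rfl, rfl⟩ := hxy
      have := I.rel_append_left (I.sat_eqn.1 ((hT _ (hlim hlr)).1 I hI) (w ++ v)) u
      simpa using this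
    | refl => exact I.equiv.refl _
    | symm _ _ _ ih => exact I.equiv.symm ih
    | trans _ _ _ _ _ ih₁ ih₂ => exact I.equiv.trans ih₁ ih₂

end Saturation

/-! ## Computing normal forms -/

section Computability

open Relation

/-- Rewrite the first occurrence of `l` to `r`. -/
def rewriteOnce {α : Type*} [DecidableEq α] (l r : List α) : List α → List α
  | [] => []
  | a :: x => if (a :: x).take l.length = l then r ++ (a :: x).drop l.length
      else a :: rewriteOnce l r x

/-- Apply the given rules one after another, each of them at most once. -/
def rewriteAll {α : Type*} [DecidableEq α] (rules : List (List α × List α)) (x : List α) :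
    List α :=
  rules.foldr (fun p y => rewriteOnce p.1 p.2 y) x

theorem primrec_rewriteOnce {α : Type*} [DecidableEq α] [Primcodable α] (l r : List α) :
    Primrec (rewriteOnce l r) := by
  have hcons : Primrec fun p : List α × α × List α × List α => p.2.1 :: p.2.2.1 :=
    Primrec.list_cons.comp (Primrec.fst.comp Primrec.snd)
      (Primrec.fst.comp (Primrec.snd.comp Primrec.snd))
  have hrec := Primrec.list_rec (f := fun x : List α => x) (g := fun _ => ([] : List α))
    (h := fun _ p => if (p.1 :: p.2.1).take l.length = l then r ++ (p.1 :: p.2.1).drop l.length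
      else p.1 :: p.2.2) Primrec.id (Primrec.const _)
    (Primrec.ite
      (Primrec.eq.comp (Primrec.list_take.comp (Primrec.const _) hcons) (Primrec.const _))
      (Primrec.list_append.comp (Primrec.const _)
        (Primrec.list_drop.comp (Primrec.const _) hcons))
      (Primrec.list_cons.comp (Primrec.fst.comp Primrec.snd)
        (Primrec.snd.comp (Primrec.snd.comp Primrec.snd))))
  refine hrec.of_eq fun x => ?_
  induction x with
  | nil => rfl
  | cons a x ih =>
    simp only [rewriteOnce]
    rw [← ih]

/-- The list of rules is fixed, so this is a finite composition of primitive recursive functions. -/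
theorem primrec_rewriteAll {α : Type*} [DecidableEq α] [Primcodable α]
    (rules : List (List α × List α)) : Primrec (rewriteAll rules) := by
  induction rules with
  | nil => exact Primrec.id
  | cons p rules ih => exact (primrec_rewriteOnce p.1 p.2).comp ih

section

variable {α : Type*} [LinearOrder α] {M : Set (Clause α)} {l r : List α}

theorem rew_of_mem (h : {eqn l r} ∈ M) (hlr : StrGT l r) (u w : List α) :
    Rew M Set.univ (u ++ (l ++ w)) (u ++ (r ++ w)) :=
  ⟨u, _, _, ⟨l, r, w, h, hlr, rfl, rfl, trivial⟩, rfl, rfl⟩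

theorem rewriteOnce_eq_or_rew (h : {eqn l r} ∈ M) (hlr : StrGT l r) (x : List α) :
    rewriteOnce l r x = x ∨ Rew M Set.univ x (rewriteOnce l r x) := by
  induction x with
  | nil => exact Or.inl rfl
  | cons a x ih =>
    rw [rewriteOnce]
    split_ifs with hx
    · right
      have := rew_of_mem h hlr [] ((a :: x).drop l.length)
      nth_rw 1 [← hx] at this
      simpa only [List.nil_append, List.take_append_drop] using this
    · exact ih.imp (congrArg _) fun h => h.append_left [a]

/-- Some occurrence of `l` is found, possibly before the given one, and replacing it strictly
decreases the string. -/
theorem rewriteOnce_ne (h : {eqn l r} ∈ M) (hlr : StrGT l r) (u w : List α) :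
    rewriteOnce l r (u ++ (l ++ w)) ≠ u ++ (l ++ w) := by
  have hl : l ≠ [] := by
    rintro rfl
    exact List.not_shortlex_nil_right hlr
  induction u with
  | nil =>
    obtain ⟨a, l', rfl⟩ := List.exists_cons_of_ne_nil hl
    have := (rew_of_mem h hlr [] w).gt
    simp only [List.nil_append, List.cons_append] at this ⊢
    rw [rewriteOnce, if_pos (by simp)]
    intro he
    simp only [List.length_cons, List.drop_succ_cons, List.drop_left] at he
    rw [he] at this
    exact strictTotal_strGT.irrefl _ this
  | cons b u ih =>
    rw [List.cons_append, rewriteOnce]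
    split_ifs with hx
    · intro he
      have := (rew_of_mem h hlr [] ((b :: (u ++ (l ++ w))).drop l.length)).gt
      nth_rw 1 [← hx] at this
      simp only [List.nil_append, List.take_append_drop, he] at this
      exact strictTotal_strGT.irrefl _ this
    · simpa using ih

theorem rewriteAll_reflTransGen {rules : List (List α × List α)}
    (h : ∀ p ∈ rules, StrGT p.1 p.2 ∧ {eqn p.1 p.2} ∈ M) (x : List α) :
    ReflTransGen (Rew M Set.univ) x (rewriteAll rules x) := by
  induction rules with
  | nil => exact .refl
  | cons p rules ih =>
    have ih := ih fun q hq => h q (List.mem_cons_of_mem _ hq)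
    obtain ⟨h₁, h₂⟩ := h p List.mem_cons_self
    change ReflTransGen _ x (rewriteOnce p.1 p.2 (rewriteAll rules x))
    rcases rewriteOnce_eq_or_rew h₂ h₁ (rewriteAll rules x) with he | hr
    · rwa [he]
    · exact ih.tail hr

theorem eq_or_strGT_of_reflTransGen {Q : Set (Clause (WithBot α))} {x y : List α}
    (h : ReflTransGen (Rew M Q) x y) : x = y ∨ StrGT x y := by
  induction h with
  | refl => exact Or.inl rfl
  | tail _ h ih =>
    rcases ih with rfl | ih
    · exact Or.inr h.gt
    · exact Or.inr (strictTotal_strGT.trans _ _ _ ih h.gt)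

/-- Each pass leaves the string alone or lowers it, so a total effect of zero means that no pass had
an effect. -/
theorem rewriteOnce_eq_of_rewriteAll_eq {rules : List (List α × List α)}
    (h : ∀ p ∈ rules, StrGT p.1 p.2 ∧ {eqn p.1 p.2} ∈ M) {x : List α}
    (hx : rewriteAll rules x = x) : ∀ p ∈ rules, rewriteOnce p.1 p.2 x = x := by
  induction rules with
  | nil => simp
  | cons p rules ih =>
    have h' := fun q hq => h q (List.mem_cons_of_mem _ hq)
    obtain ⟨h₁, h₂⟩ := h p List.mem_cons_self
    change rewriteOnce p.1 p.2 (rewriteAll rules x) = x at hx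
    have ht := strictTotal_strGT (β := α)
    have hall : rewriteAll rules x = x := by
      rcases eq_or_strGT_of_reflTransGen (rewriteAll_reflTransGen h' x) with he | hgt
      · exact he.symm
      · rcases rewriteOnce_eq_or_rew h₂ h₁ (rewriteAll rules x) with he | hr
        · rw [← he, hx]
        · rw [hx] at hr
          exact absurd hgt (ht.asymm hr.gt)
    rintro q hq
    rcases List.mem_cons.1 hq with rfl | hq
    · rwa [hall] at hx
    · exact ih h' hall q hq

/-- Finitely many clauses contain finitely many oriented equations. -/
theorem finite_orientedEquations (hfin : M.Finite) :
    {p : List α × List α | StrGT p.1 p.2 ∧ {eqn p.1 p.2} ∈ M}.Finite := by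
  refine Set.Finite.of_finite_image (f := fun p => ({eqn p.1 p.2} : Clause α))
    (hfin.subset ?_) ?_
  · rintro _ ⟨p, hp, rfl⟩
    exact hp.2
  · rintro ⟨s, t⟩ ⟨hst, -⟩ ⟨s', t'⟩ ⟨hst', -⟩ he
    have he' : s(s, t) = s(s', t') := by simpa [eqn] using he
    rcases Sym2.eq_iff.1 he' with ⟨rfl, rfl⟩ | ⟨rfl, rfl⟩
    · rfl
    · exact absurd hst (strictTotal_strGT.asymm hst')

end

/-- If an equivalence relation is joinability with respect to a terminating relation, and a
computable function rewrites every element that is not a normal form, then the equivalence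
relation is decidable. -/
theorem computablePred_of_join {X : Type*} [Primcodable X] {r P : X → X → Prop}
    (hP : Equivalence P) (hPr : ∀ x y, P x y ↔ Join (ReflTransGen r) x y)
    (hwf : WellFounded fun x y => r y x) {step : X → X} (hstep : Primrec step)
    (hred : ∀ x, ReflTransGen r x (step x)) (hnf : ∀ x, step x = x → ∀ y, ¬ r x y) :
    ComputablePred fun p : X × X => P p.1 p.2 := by
  classical
  have hiter : ∀ n x, P x (step^[n] x) := by
    intro n x
    induction n with
    | zero => exact hP.refl x
    | succ n ih =>
      rw [Function.iterate_succ_apply']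
      exact hP.trans ih ((hPr _ _).2 ⟨_, hred _, .refl⟩)
  -- Stability from some `n` on lets two strings be tested at one common number of iterations.
  have hfix : ∀ x, ∃ n, ∀ m, n ≤ m → step (step^[m] x) = step^[m] x := by
    intro x
    suffices ∃ n, step (step^[n] x) = step^[n] x by
      obtain ⟨n, hn⟩ := this
      refine ⟨n, fun m hm => ?_⟩
      induction m, hm using Nat.le_induction with
      | base => exact hn
      | succ m _ ih => rw [Function.iterate_succ_apply', ih, ih]
    -- The transitive closure is needed because one application of `step` may perform several
    -- rewrites.
    induction x using hwf.transGen.induction with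
    | _ x ih =>
      by_cases hx : step x = x
      · exact ⟨0, hx⟩
      · have hgen : TransGen (fun x y => r y x) (step x) x := by
          rcases (reflTransGen_iff_eq_or_transGen.1 (hred x)) with he | h
          · exact absurd he hx
          · exact transGen_swap.1 h
        obtain ⟨n, hn⟩ := ih _ hgen
        exact ⟨n + 1, by simpa only [Function.iterate_succ_apply] using hn⟩
  have hit : Primrec₂ fun (x : X) n => step^[n] x :=
    Primrec.nat_iterate Primrec.snd Primrec.fst (hstep.comp Primrec.snd).to₂
  have hit₁ : Primrec fun q : (X × X) × ℕ => step^[q.2] q.1.1 :=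
    hit.comp (Primrec.fst.comp Primrec.fst) Primrec.snd
  have hit₂ : Primrec fun q : (X × X) × ℕ => step^[q.2] q.1.2 :=
    hit.comp (Primrec.snd.comp Primrec.fst) Primrec.snd
  have htest : Primrec₂ fun (p : X × X) n => decide (step (step^[n] p.1) = step^[n] p.1 ∧
      step (step^[n] p.2) = step^[n] p.2) :=
    ((Primrec.eq.comp (hstep.comp hit₁) hit₁).and
      (Primrec.eq.comp (hstep.comp hit₂) hit₂)).decide
  have hans : Primrec₂ fun (p : X × X) n => decide (step^[n] p.1 = step^[n] p.2) :=
    (Primrec.eq.comp hit₁ hit₂).decide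
  -- The algorithm searches for an `n` at which both iterates are stable, then compares them; `hfix`
  -- makes the search terminate.
  refine ⟨fun _ => Classical.propDecidable _, Partrec.of_eq_tot
    ((Partrec.rfind htest.to_comp.partrec₂).map hans.to_comp) fun p => ?_⟩
  obtain ⟨n₁, hn₁⟩ := hfix p.1
  obtain ⟨n₂, hn₂⟩ := hfix p.2
  obtain ⟨n, hn, -⟩ := Nat.rfind_min' (p := fun n => decide (step (step^[n] p.1) = step^[n] p.1 ∧
      step (step^[n] p.2) = step^[n] p.2)) (m := max n₁ n₂)
      (by simp [hn₁ _ (le_max_left _ _), hn₂ _ (le_max_right _ _)])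
  refine (Part.mem_map_iff _).2 ⟨n, hn, ?_⟩
  have htrue := Nat.rfind_spec hn
  obtain ⟨h₁, h₂⟩ : step (step^[n] p.1) = step^[n] p.1 ∧ step (step^[n] p.2) = step^[n] p.2 := by
    simpa using htrue
  rw [decide_eq_decide]
  constructor
  · intro he
    exact hP.trans (hiter n p.1) (he ▸ hP.symm (hiter n p.2))
  · intro h
    obtain ⟨z, hz₁, hz₂⟩ := (hPr _ _).1
      (hP.trans (hP.symm (hiter n p.1)) (hP.trans h (hiter n p.2)))
    rcases ReflTransGen.cases_head hz₁ with he₁ | ⟨y, hy, -⟩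
    · rcases ReflTransGen.cases_head hz₂ with he₂ | ⟨y, hy, -⟩
      · rw [he₁, he₂]
      · exact absurd hy (hnf _ h₂ y)
    · exact absurd hy (hnf _ h₁ y)

theorem equivalence_entails {α : Type*} (R : Set (Clause α)) :
    Equivalence fun s t => Entails R {eqn s t} where
  refl _ I _ := I.sat_eqn.2 fun _ => I.equiv.refl _
  symm h I hI := I.sat_eqn.2 fun w => I.equiv.symm (I.sat_eqn.1 (h I hI) w)
  trans h₁ h₂ I hI := I.sat_eqn.2 fun w =>
    I.equiv.trans (I.sat_eqn.1 (h₁ I hI) w) (I.sat_eqn.1 (h₂ I hI) w)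

end Computability

end StringSup

theorem mainTheorem4 {α : Type*} [LinearOrder α] [Finite α] [Primcodable α]
    (f : StringSup.Selection α) (R : Set (StringSup.Clause α))
    (hR : ∀ C ∈ R, StringSup.IsConditionalEquation C)
    (S : ℕ → Set (StringSup.Clause α)) (hS₀ : S 0 = R)
    (hS : StringSup.IsDerivation f S) (hfair : StringSup.Fair f S)
    (hfin : (StringSup.limitSet S).Finite) :
    StringSup.DecidableWordProblems R := by
  subst hS₀
  -- The rule list is obtained nonconstructively from finiteness, which suffices: for each theory
  -- only the existence of an algorithm is claimed.
  have hU := StringSup.finite_orientedEquations hfin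
  have hrules : ∀ p ∈ hU.toFinset.toList, StringSup.StrGT p.1 p.2 ∧
      {StringSup.eqn p.1 p.2} ∈ StringSup.limitSet S := fun p hp => by simpa using hp
  refine StringSup.computablePred_of_join (StringSup.equivalence_entails (S 0))
    (StringSup.entails_iff_join hR hS hfair) StringSup.wellFounded_rew
    (StringSup.primrec_rewriteAll hU.toFinset.toList)
    (StringSup.rewriteAll_reflTransGen hrules) fun x hx y hxy => ?_
  obtain ⟨u, p, q, ⟨l, r, w, hM, hlr, rfl, rfl, -⟩, rfl, rfl⟩ := hxy
  exact StringSup.rewriteOnce_ne hM hlr u w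
    (StringSup.rewriteOnce_eq_of_rewriteAll_eq hrules hx (l, r) (by simpa using ⟨hlr, hM⟩))
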